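/- Let $0<k_1<k_2$, let $f_j(x,t)=\exp(-k_jx+k_j^3t)$ for $x\in\mathbb{C}$, $t\in\mathbb{R}$, $j=1,2$, and let $\gamma=\frac{k_2+k_1}{k_2-k_1}$. Put $$g^+=-\gamma\,\frac{f_1+f_2}{1-f_1f_2},\qquad g^-=\gamma\,\frac{f_1-f_2}{1+f_1f_2},\qquad u^\pm=2(\arctan g^\pm)_x=\frac{2g^\pm_x}{1+(g^\pm)^2},$$ $$F^+=(1-f_1f_2)^2+\gamma^2(f_1+f_2)^2,\qquad F^-=(1+f_1f_2)^2+\gamma^2(f_1-f_2)^2,$$ so that $u^\pm$ are two-soliton solutions of the modified Korteweg--de Vries equation $u_t+6u^2u_x+u_{xxx}=0$. Call $(k_1,k_2)$ exceptional for $F^+$ (respectively $F^-$) if $k_2/k_1=p_2/p_1$ with coprime odd positive integers $p_1,p_2$ such that $4\mid p_2+p_1$ (respectively $4\mid p_2-p_1$). In the following fix one of the two signs $\pm$ in $F^\pm$, $u^\pm$. In the non-exceptional case let $J_-=J_+=\mathbb{R}$; in the exceptional case let $J_-=(-\infty,0)$ and $J_+=(0,\infty)$. A curve of zeros on $J$ is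 a real-analytic map $x:J\to\mathbb{C}$ with $F^\pm(x(t),t)=0$ for all $t\in J$. For every $t\in\mathbb{R}$, the poles of $u^\pm(\cdot,t)$ in $\mathbb{C}$ are exactly the zeros of $F^\pm(\cdot,t)$. The asymptotic behaviors of the curves of zeros are completely described as follows. 1. For every odd $m\in\mathbb{Z}$ there is exactly one curve of zeros $x$ on $J_-$ such that $x(t)=k_1^2t+\frac1{k_1}\log\gamma+\frac{m\pi i}{2k_1}+o(1)$ as $t\to-\infty$. 2. For every odd $m\in\mathbb{Z}$ there is exactly one curve of zeros $x$ on $J_+$ such that $x(t)=k_1^2t-\frac1{k_1}\log\gamma-\frac{m\pi i}{2k_1}+o(1)$ as $t\to\infty$. 3. For every odd $n\in\mathbb{Z}$ there is exactly one curve of zeros $x$ on $J_-$ such that $x(t)=k_2^2t-\frac1{k_2}\log\gamma+\frac{n\pi i}{2k_2}+o(1)$ as $t\to-\infty$. 4. For every odd $n\in\mathbb{Z}$ there is exactly one curve of zeros $x$ on $J_+$ such that $x(t)=k_2^2t+\frac1{k_2}\log\gamma-\frac{n\pi i}{2k_2}+o(1)$ as $t\to\infty$. 5. Every curve of zeros on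 $J_-$ is one of those in 1 and 3, and every curve of zeros on $J_+$ is one of those in 2 and 4. 6. For every $t\in J_-$ (respectively $t\in J_+$), every zero of $F^\pm(\cdot,t)$ is $x(t)$ for some curve of zeros $x$ on $J_-$ (respectively $J_+$), so the curves in 1 and 3 (respectively 2 and 4) exhaust the zeros. -/

import Mathlib

open Filter Topology Set

noncomputable section

namespace MKdV

/-- The exponential `f_j(x,t) = exp(-k_j x + k_j³ t)`, `x` complex, `t` real. -/
def f (k : ℝ) (x : ℂ) (t : ℝ) : ℂ :=
  Complex.exp (-(k : ℂ) * x + (k : ℂ) ^ 3 * (t : ℂ))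

/-- `γ = (k₂ + k₁) / (k₂ - k₁)`. -/
def gam (k₁ k₂ : ℝ) : ℝ := (k₂ + k₁) / (k₂ - k₁)

/-- The functions `g^±`; the sign is `σ = 1` for `g⁺ = -γ (f₁ + f₂) / (1 - f₁ f₂)` and
`σ = -1` for `g⁻ = γ (f₁ - f₂) / (1 + f₁ f₂)`. -/
def g (k₁ k₂ : ℝ) (σ : ℤˣ) (x : ℂ) (t : ℝ) : ℂ :=
  -((σ : ℤ) : ℂ) * (gam k₁ k₂ : ℂ) * (f k₁ x t + ((σ : ℤ) : ℂ) * f k₂ x t) /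
    (1 - ((σ : ℤ) : ℂ) * (f k₁ x t * f k₂ x t))

/-- The two-soliton solution `u^± = 2 (arctan g^±)_x = 2 g^±_x / (1 + (g^±)²)`, as a meromorphic
function of `x` for each `t`. Lean gives it arbitrary values on the discrete set of points where
a denominator vanishes; these values do not affect which points are poles. -/
def u (k₁ k₂ : ℝ) (σ : ℤˣ) (x : ℂ) (t : ℝ) : ℂ :=
  2 * deriv (fun y : ℂ => g k₁ k₂ σ y t) x / (1 + g k₁ k₂ σ x t ^ 2)

/-- `F^±`: `F⁺ = (1 - f₁ f₂)² + γ² (f₁ + f₂)²` for `σ = 1` and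
`F⁻ = (1 + f₁ f₂)² + γ² (f₁ - f₂)²` for `σ = -1`. -/
def F (k₁ k₂ : ℝ) (σ : ℤˣ) (x : ℂ) (t : ℝ) : ℂ :=
  (1 - ((σ : ℤ) : ℂ) * (f k₁ x t * f k₂ x t)) ^ 2 +
    (gam k₁ k₂ : ℂ) ^ 2 * (f k₁ x t + ((σ : ℤ) : ℂ) * f k₂ x t) ^ 2

/-- The exceptional case: `k₂ / k₁ = p₂ / p₁` with coprime odd natural numbers `p₁`, `p₂` such
that `4` divides `p₂ + p₁` (for `F⁺`), respectively `p₂ - p₁` (for `F⁻`). -/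
def IsExceptional (k₁ k₂ : ℝ) (σ : ℤˣ) : Prop :=
  ∃ p₁ p₂ : ℕ, Nat.Coprime p₁ p₂ ∧ Odd p₁ ∧ Odd p₂ ∧ k₂ / k₁ = (p₂ : ℝ) / (p₁ : ℝ) ∧
    (4 : ℤ) ∣ (p₂ : ℤ) + (σ : ℤ) * (p₁ : ℤ)

/-- The time interval on which curves of zeros are considered as `t → -∞`:
all of `ℝ`, but only `t < 0` in the exceptional case. -/
def pastTimes (k₁ k₂ : ℝ) (σ : ℤˣ) : Set ℝ := {t | IsExceptional k₁ k₂ σ → t < 0}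

/-- The time interval on which curves of zeros are considered as `t → ∞`:
all of `ℝ`, but only `t > 0` in the exceptional case. -/
def futureTimes (k₁ k₂ : ℝ) (σ : ℤˣ) : Set ℝ := {t | IsExceptional k₁ k₂ σ → 0 < t}

/-- `x` is an analytic curve of zeros of `F^±(·,t)`, `t` in the interval `J`.
Values of `x` outside `J` are irrelevant. -/
def IsZeroCurve (k₁ k₂ : ℝ) (σ : ℤˣ) (J : Set ℝ) (x : ℝ → ℂ) : Prop :=
  AnalyticOnNhd ℝ x J ∧ ∀ t ∈ J, F k₁ k₂ σ (x t) t = 0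

/-- `k² t + a + mπi/(2k)`: for odd `m`, these are the poles of the single soliton of speed `k²`
that is centred at `a` at time `0`. -/
def solitonPole (k a : ℝ) (m : ℤ) (t : ℝ) : ℂ :=
  (k : ℂ) ^ 2 * (t : ℂ) + (a : ℂ) + (m : ℂ) * (Real.pi : ℂ) * Complex.I / (2 * (k : ℂ))

/-- `x(t) = y(t) + o(1)` along the filter `l`. -/
def AsympTo (l : Filter ℝ) (x y : ℝ → ℂ) : Prop :=
  Tendsto (fun t => x t - y t) l (𝓝 0)

/-- Up to its values outside `J`, there is exactly one curve of zeros of `F^±(·,t)`, `t ∈ J`,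
that equals `y(t) + o(1)` along `l`. -/
def ExistsUniqueZeroCurve (k₁ k₂ : ℝ) (σ : ℤˣ) (J : Set ℝ) (l : Filter ℝ) (y : ℝ → ℂ) : Prop :=
  ∃ x : ℝ → ℂ, (IsZeroCurve k₁ k₂ σ J x ∧ AsympTo l x y) ∧
    ∀ x' : ℝ → ℂ, IsZeroCurve k₁ k₂ σ J x' → AsympTo l x' y → EqOn x' x J

end MKdV

end

namespace MKdV

open scoped ContDiff

/-! The whole argument rests on a factorisation. For `c = ±i`, put `a = c f₁` and `b = σ c f₂`. Then
`F` is the product over the two values of `c` of `G = 1 + ab + γ(a + b)`, so on each factor `a` and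
`b` are linked by a Möbius relation.

Simplicity: if a factor has a double zero, or both factors vanish at once, then `f₁ = -σ f₂` and
`f₂² = -1`. Comparing moduli forces `t = 0`; comparing arguments forces the arithmetic condition
defining the exceptional case (`eq_zero_and_isExceptional`). All other zeros are simple.

Poles: up to the constant `σ i`, `u` is the logarithmic derivative of the quotient of the two
factors. At a zero of `F` the two factors have different orders, even when both vanish
(`meromorphicOrderAt_G_ne`), so a pole is always present.

Continuation: zeros cannot cross certain horizontal lines, and their real parts are bounded for
bounded time. In a strip between such lines, projection of the zero set to the time axis is
therefore proper, and by the implicit function theorem it is a local homeomorphism over `J`. It is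
then a covering over an interval, and every zero extends to a curve on all of `J`
(`exists_zero_curve`).

Asymptotics as `t → -∞`: at each point either `b` is small or `a` is large. The Möbius relation then
gives `γ a ≈ -1` or `b ≈ -γ`, that is, proximity to a slow or a fast soliton pole; the factor `γ`
produces the phase shifts. Near each such pole there is exactly one zero. Since the poles stay
apart, a continuous curve of zeros cannot change from one pole to another, and the identity theorem
gives uniqueness. The symmetry `(x, t) ↦ (-x, -t)` of the zero set transfers everything to `t → ∞`.
-/

theorem one_lt_gam {k₁ k₂ : ℝ} (hk₁ : 0 < k₁) (hk₂ : k₁ < k₂) : 1 < gam k₁ k₂ := by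
  unfold gam
  rw [one_lt_div (by linarith)]
  linarith

/-! ### The exponentials and the factorisation of `F` -/

theorem intUnits_cast_sq (σ : ℤˣ) : (((σ : ℤ) : ℂ)) ^ 2 = 1 := by
  rcases Int.units_eq_one_or σ with rfl | rfl <;> simp

theorem f_ne_zero (k : ℝ) (x : ℂ) (t : ℝ) : f k x t ≠ 0 := Complex.exp_ne_zero _

theorem f_neg_neg (k : ℝ) (x : ℂ) (t : ℝ) : f k (-x) (-t) = (f k x t)⁻¹ := by
  rw [f, f, ← Complex.exp_neg]
  congr 1
  push_cast
  ring

theorem f_add (k : ℝ) (x w : ℂ) (t : ℝ) : f k (x + w) t = f k x t * Complex.exp (-k * w) := by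
  rw [f, f, ← Complex.exp_add]
  congr 1
  ring

theorem norm_f (k : ℝ) (x : ℂ) (t : ℝ) : ‖f k x t‖ = Real.exp (-k * x.re + k ^ 3 * t) := by
  rw [f, Complex.norm_exp]
  congr 1
  have : (-(k : ℂ) * x + (k : ℂ) ^ 3 * (t : ℂ)) = ((-k : ℝ) : ℂ) * x + ((k ^ 3 * t : ℝ) : ℂ) := by
    push_cast; ring
  rw [this, Complex.add_re, Complex.re_ofReal_mul, Complex.ofReal_re]

theorem hasDerivAt_f (k : ℝ) (x : ℂ) (t : ℝ) :
    HasDerivAt (fun y => f k y t) (-k * f k x t) x := by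
  have h : HasDerivAt (fun y : ℂ => -(k : ℂ) * y + (k : ℂ) ^ 3 * (t : ℂ)) (-k) x := by
    simpa using ((hasDerivAt_id x).const_mul (-(k : ℂ))).add_const ((k : ℂ) ^ 3 * (t : ℂ))
  simpa [f, mul_comm] using h.cexp

/-- The factor `1 - σ f₁ f₂ + c γ (f₁ + σ f₂)` of `F`, where `c² = -1`. -/
noncomputable def G (k₁ k₂ : ℝ) (σ : ℤˣ) (c x : ℂ) (t : ℝ) : ℂ :=
  (1 - ((σ : ℤ) : ℂ) * (f k₁ x t * f k₂ x t)) +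
    c * (gam k₁ k₂ : ℂ) * (f k₁ x t + ((σ : ℤ) : ℂ) * f k₂ x t)

theorem F_eq_mul (k₁ k₂ : ℝ) (σ : ℤˣ) {c : ℂ} (hc : c ^ 2 = -1) (x : ℂ) (t : ℝ) :
    F k₁ k₂ σ x t = G k₁ k₂ σ c x t * G k₁ k₂ σ (-c) x t := by
  unfold F G
  linear_combination ((gam k₁ k₂ : ℂ) ^ 2 * (f k₁ x t + ((σ : ℤ) : ℂ) * f k₂ x t) ^ 2) * hc

theorem exists_G_eq_zero {k₁ k₂ : ℝ} {σ : ℤˣ} {x : ℂ} {t : ℝ} (h : F k₁ k₂ σ x t = 0) :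
    ∃ c : ℂ, c ^ 2 = -1 ∧ G k₁ k₂ σ c x t = 0 := by
  rw [F_eq_mul k₁ k₂ σ Complex.I_sq, mul_eq_zero] at h
  rcases h with h | h
  · exact ⟨_, Complex.I_sq, h⟩
  · exact ⟨_, by simp, h⟩

/-- Absorbing `c` into the exponentials makes the factor symmetric in its two variables and removes
`σ` and `c` from the coefficients; most estimates use this form. -/
theorem G_eq (k₁ k₂ : ℝ) (σ : ℤˣ) {c : ℂ} (hc : c ^ 2 = -1) (x : ℂ) (t : ℝ) :
    G k₁ k₂ σ c x t = 1 + (c * f k₁ x t) * (((σ : ℤ) : ℂ) * c * f k₂ x t) +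
      gam k₁ k₂ * (c * f k₁ x t + ((σ : ℤ) : ℂ) * c * f k₂ x t) := by
  unfold G
  linear_combination (-((σ : ℤ) : ℂ) * (f k₁ x t * f k₂ x t)) * hc

/-- Reflection inverts both exponentials, and clearing denominators restores the two squares. This
symmetry supplies the case `t → ∞` and the lower bound on real parts of zeros. -/
theorem F_neg_neg (k₁ k₂ : ℝ) (σ : ℤˣ) (x : ℂ) (t : ℝ) :
    F k₁ k₂ σ (-x) (-t) = F k₁ k₂ σ x t / (f k₁ x t * f k₂ x t) ^ 2 := by
  have h₁ := f_ne_zero k₁ x t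
  have h₂ := f_ne_zero k₂ x t
  unfold F
  rw [f_neg_neg, f_neg_neg]
  rcases Int.units_eq_one_or σ with rfl | rfl <;> · simp; field_simp; ring

theorem F_neg_neg_eq_zero_iff (k₁ k₂ : ℝ) (σ : ℤˣ) (x : ℂ) (t : ℝ) :
    F k₁ k₂ σ (-x) (-t) = 0 ↔ F k₁ k₂ σ x t = 0 := by
  rw [F_neg_neg, div_eq_zero_iff]
  simp [f_ne_zero]

theorem hasDerivAt_G (k₁ k₂ : ℝ) (σ : ℤˣ) (c x : ℂ) (t : ℝ) :
    HasDerivAt (fun y => G k₁ k₂ σ c y t)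
      ((k₁ + k₂) * ((σ : ℤ) : ℂ) * (f k₁ x t * f k₂ x t) -
        c * gam k₁ k₂ * (k₁ * f k₁ x t + ((σ : ℤ) : ℂ) * (k₂ * f k₂ x t))) x := by
  unfold G
  have h₁ := hasDerivAt_f k₁ x t
  have h₂ := hasDerivAt_f k₂ x t
  exact ((((h₁.mul h₂).const_mul ((σ : ℤ) : ℂ)).const_sub 1).add
    ((h₁.add (h₂.const_mul ((σ : ℤ) : ℂ))).const_mul (c * (gam k₁ k₂ : ℂ)))).congr_deriv (by ring)

/-! ### Degenerate zeros and the exceptional case -/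

theorem gam_mul {k₁ k₂ : ℝ} (hk₂ : k₁ < k₂) : (gam k₁ k₂ : ℂ) * (k₂ - k₁) = k₂ + k₁ := by
  have h : gam k₁ k₂ * (k₂ - k₁) = k₂ + k₁ := by
    unfold gam
    rw [div_mul_cancel₀ _ (by linarith)]
  exact_mod_cast h

theorem gam_ne_zero {k₁ k₂ : ℝ} (hk₁ : 0 < k₁) (hk₂ : k₁ < k₂) : (gam k₁ k₂ : ℂ) ≠ 0 := by
  have := one_lt_gam hk₁ hk₂
  exact_mod_cast (by linarith : gam k₁ k₂ ≠ 0)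

theorem gam_add_one_ne_zero {k₁ k₂ : ℝ} (hk₁ : 0 < k₁) (hk₂ : k₁ < k₂) :
    (gam k₁ k₂ : ℂ) + 1 ≠ 0 := by
  have := one_lt_gam hk₁ hk₂
  exact_mod_cast (by linarith : gam k₁ k₂ + 1 ≠ 0)

/-- If both factors of `F` vanish, then `f₁` and `f₂` are `±i` with `σ f₁ f₂ = 1`. -/
theorem f_eq_of_G_eq_zero_of_G_neg_eq_zero {k₁ k₂ : ℝ} (hk₁ : 0 < k₁) (hk₂ : k₁ < k₂) {σ : ℤˣ}
    {c x : ℂ} {t : ℝ} (hc : c ^ 2 = -1) (h : G k₁ k₂ σ c x t = 0) (h' : G k₁ k₂ σ (-c) x t = 0) :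
    f k₁ x t = -((σ : ℤ) : ℂ) * f k₂ x t ∧ f k₂ x t ^ 2 = -1 := by
  have hc0 : c ≠ 0 := by rintro rfl; norm_num at hc
  have hp : f k₁ x t + ((σ : ℤ) : ℂ) * f k₂ x t = 0 := by
    have : 2 * (c * (gam k₁ k₂ : ℂ)) * (f k₁ x t + ((σ : ℤ) : ℂ) * f k₂ x t) = 0 := by
      unfold G at h h'; linear_combination h - h'
    simpa [hc0, gam_ne_zero hk₁ hk₂] using this
  have hq : 1 - ((σ : ℤ) : ℂ) * (f k₁ x t * f k₂ x t) = 0 := by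
    unfold G at h; rw [hp] at h; simpa using h
  refine ⟨by linear_combination hp, ?_⟩
  have hσ := intUnits_cast_sq σ
  linear_combination hq + ((σ : ℤ) : ℂ) * f k₂ x t * hp - f k₂ x t ^ 2 * hσ

/-- If a factor of `F` vanishes to second order, then `f₁` and `f₂` are `±i` with `σ f₁ f₂ = 1`. -/
theorem f_eq_of_G_eq_zero_of_deriv_eq_zero {k₁ k₂ : ℝ} (hk₁ : 0 < k₁) (hk₂ : k₁ < k₂) {σ : ℤˣ}
    {c x : ℂ} {t : ℝ} (hc : c ^ 2 = -1) (h : G k₁ k₂ σ c x t = 0)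
    (h' : (k₁ + k₂) * ((σ : ℤ) : ℂ) * (f k₁ x t * f k₂ x t) -
        c * gam k₁ k₂ * (k₁ * f k₁ x t + ((σ : ℤ) : ℂ) * (k₂ * f k₂ x t)) = 0) :
    f k₁ x t = -((σ : ℤ) : ℂ) * f k₂ x t ∧ f k₂ x t ^ 2 = -1 := by
  have hσ := intUnits_cast_sq σ
  have hg := gam_mul hk₂
  have hk₁' : (k₁ : ℂ) ≠ 0 := by exact_mod_cast hk₁.ne'
  rw [G_eq _ _ _ hc] at h
  set γ : ℂ := (gam k₁ k₂ : ℂ)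
  set s : ℂ := ((σ : ℤ) : ℂ)
  set a : ℂ := c * f k₁ x t with ha
  set b : ℂ := s * c * f k₂ x t with hb
  have e : (k₁ + k₂) * (a * b) + γ * (k₁ * a + k₂ * b) = 0 := by
    rw [ha, hb]; linear_combination (-1 : ℂ) * h' + (k₁ + k₂) * s * f k₁ x t * f k₂ x t * hc
  -- Since `k₁ + k₂ = γ (k₂ - k₁)`, a factor `γ` cancels from the derivative condition.
  have e' : (k₂ - k₁) * (a * b) + (k₁ * a + k₂ * b) = 0 :=
    (mul_eq_zero.mp (by linear_combination e + a * b * hg :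
      γ * ((k₂ - k₁) * (a * b) + (k₁ * a + k₂ * b)) = 0)).resolve_left (gam_ne_zero hk₁ hk₂)
  -- Eliminating `a` between `e'` and `h` leaves a quadratic in `b` that is a perfect square,
  -- precisely because of the value of `γ`.
  have e2 : (k₁ : ℂ) * (b - 1) ^ 2 = 0 := by
    linear_combination (-(γ + b)) * e' + ((k₂ - k₁) * b + k₁) * h + (b - b ^ 2) * hg
  have hb1 : b = 1 := by
    have : (b - 1) ^ 2 = 0 := by simpa [hk₁'] using e2
    exact sub_eq_zero.mp (pow_eq_zero_iff two_ne_zero |>.mp this)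
  have ha1 : a = -1 := by
    have : (γ + 1) * (a + 1) = 0 := by rw [hb1] at h; linear_combination h
    have := (mul_eq_zero.mp this).resolve_left (gam_add_one_ne_zero hk₁ hk₂)
    linear_combination this
  have hc0 : c ≠ 0 := by rintro rfl; norm_num at hc
  refine ⟨?_, ?_⟩
  · apply mul_left_cancel₀ hc0
    linear_combination ha1 - ha + hb1 - hb
  · have : b ^ 2 = 1 := by rw [hb1]; norm_num
    rw [hb] at this
    linear_combination (-1 : ℂ) * this + f k₂ x t ^ 2 * c ^ 2 * hσ + f k₂ x t ^ 2 * hc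

/-- The two odd integers need be neither coprime nor positive. Their gcd is odd, so dividing by it
preserves divisibility by 4. Their ratio is positive, so they share a sign and may be replaced by
absolute values. -/
theorem isExceptional_of_odd_ratio {k₁ k₂ : ℝ} (hk₁ : 0 < k₁) (hk₂ : k₁ < k₂) {σ : ℤˣ} {n l : ℤ}
    (h : k₂ * (1 + 2 * n) = k₁ * (1 + 2 * l)) (hσ : σ = (-1 : ℤˣ) ^ (1 + n + l)) :
    IsExceptional k₁ k₂ σ := by
  have h4 : (4 : ℤ) ∣ (1 + 2 * l) + σ * (1 + 2 * n) := by
    rcases Int.even_or_odd (1 + n + l) with he | ho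
    · rw [he.neg_one_zpow] at hσ
      rw [hσ]
      obtain ⟨r, hr⟩ := he
      refine ⟨r, ?_⟩
      push_cast
      omega
    · rw [ho.neg_one_zpow] at hσ
      rw [hσ]
      obtain ⟨r, hr⟩ := ho
      refine ⟨r - n, ?_⟩
      push_cast
      omega
  obtain ⟨p, q, hcop, hp, hq⟩ := Int.exists_gcd_one (m := 1 + 2 * n) (n := 1 + 2 * l)
    (Int.gcd_pos_of_ne_zero_left _ (by omega))
  set d : ℤ := (Int.gcd (1 + 2 * n) (1 + 2 * l) : ℤ)
  have hoddn : Odd (p * d) := hp ▸ ⟨n, by ring⟩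
  have hoddl : Odd (q * d) := hq ▸ ⟨l, by ring⟩
  rw [Int.odd_mul] at hoddn hoddl
  have hd0 : (d : ℝ) ≠ 0 := by
    have : d ≠ 0 := by rintro h0; simp [h0] at hoddn
    exact_mod_cast this
  have hr : k₂ * p = k₁ * q := by
    have e1 : (1 + 2 * n : ℝ) = p * d := by exact_mod_cast hp
    have e2 : (1 + 2 * l : ℝ) = q * d := by exact_mod_cast hq
    rw [e1, e2, ← mul_assoc, ← mul_assoc] at h
    exact mul_right_cancel₀ hd0 h
  have h4' : (4 : ℤ) ∣ q + σ * p := by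
    have hc : IsCoprime (4 : ℤ) d := by
      have h2 : IsCoprime (2 : ℤ) d :=
        Int.isCoprime_iff_gcd_eq_one.2 (Nat.coprime_two_left.2 (Int.natAbs_odd.2 hoddn.2) :)
      have : IsCoprime ((2 : ℤ) ^ 2) d := h2.pow_left
      simpa using this
    refine hc.dvd_of_dvd_mul_right ?_
    rw [hp, hq] at h4
    rwa [add_mul, mul_assoc]
  have hp0 : (p : ℝ) ≠ 0 := by
    have : p ≠ 0 := by rintro h0; simp [h0] at hoddn
    exact_mod_cast this
  have hratio : k₂ / k₁ = (q : ℝ) / p := by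
    rw [div_eq_div_iff hk₁.ne' hp0, hr]; ring
  have hpos : 0 < (q : ℝ) / p := hratio ▸ div_pos (by linarith) hk₁
  refine ⟨p.natAbs, q.natAbs, by simpa [Int.gcd] using hcop, Int.natAbs_odd.2 hoddn.1,
    Int.natAbs_odd.2 hoddl.1, ?_, ?_⟩
  · rw [hratio, Nat.cast_natAbs, Nat.cast_natAbs, Int.cast_abs, Int.cast_abs, ← abs_div,
      abs_of_pos hpos]
  · rw [Int.natCast_natAbs, Int.natCast_natAbs]
    rcases div_pos_iff.1 hpos with ⟨hq', hp'⟩ | ⟨hq', hp'⟩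
    · rwa [abs_of_pos (by exact_mod_cast hq'), abs_of_pos (by exact_mod_cast hp')]
    · rw [abs_of_neg (by exact_mod_cast hq'), abs_of_neg (by exact_mod_cast hp')]
      rwa [mul_neg, ← neg_add, dvd_neg]

theorem exists_int_of_f_sq_eq_neg_one {k : ℝ} (hk : 0 < k) {x : ℂ} {t : ℝ}
    (h : f k x t ^ 2 = -1) :
    x.re = k ^ 2 * t ∧ ∃ n : ℤ, -(2 * k * x.im) = Real.pi * (1 + 2 * n) ∧
      f k x t = Complex.exp (Real.pi * (1 + 2 * n) / 2 * Complex.I) := by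
  rw [f, ← Complex.exp_nat_mul, ← Complex.exp_pi_mul_I, Complex.exp_eq_exp_iff_exists_int] at h
  obtain ⟨n, hn⟩ := h
  have hre := congrArg Complex.re hn
  have him := congrArg Complex.im hn
  simp only [← Complex.ofReal_pow, ← Complex.ofReal_neg, ← Complex.ofReal_mul, Nat.cast_ofNat,
    Complex.mul_re, Complex.mul_im, Complex.add_re, Complex.add_im, Complex.ofReal_re,
    Complex.ofReal_im, Complex.I_re, Complex.I_im, Complex.re_ofNat, Complex.im_ofNat,
    Complex.intCast_re, Complex.intCast_im] at hre him
  refine ⟨?_, n, ?_, ?_⟩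
  · exact mul_left_cancel₀ hk.ne' (by linear_combination -hre / 2)
  · linear_combination him
  · rw [f]
    congr 1
    push_cast at hn
    linear_combination hn / 2

/-- Both exponentials are `±i`. Their moduli give `Re x = k₁² t = k₂² t`, hence `t = 0`. Their
arguments make `k₁ Im x` and `k₂ Im x` odd multiples of `π/2`, and `f₁ f₂ = σ` fixes the parity that
decides divisibility by 4. -/
theorem eq_zero_and_isExceptional {k₁ k₂ : ℝ} (hk₁ : 0 < k₁) (hk₂ : k₁ < k₂) {σ : ℤˣ} {x : ℂ}
    {t : ℝ} (h₁ : f k₁ x t = -((σ : ℤ) : ℂ) * f k₂ x t) (h₂ : f k₂ x t ^ 2 = -1) :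
    t = 0 ∧ IsExceptional k₁ k₂ σ := by
  have hσ := intUnits_cast_sq σ
  have h₁' : f k₁ x t ^ 2 = -1 := by rw [h₁]; linear_combination h₂ + f k₂ x t ^ 2 * hσ
  obtain ⟨hr₁, n, hn, hfn⟩ := exists_int_of_f_sq_eq_neg_one hk₁ h₁'
  obtain ⟨hr₂, l, hl, hfl⟩ := exists_int_of_f_sq_eq_neg_one (hk₁.trans hk₂) h₂
  have ht : t = 0 := by
    have : (k₂ - k₁) * ((k₂ + k₁) * t) = 0 := by linear_combination hr₁ - hr₂
    have h1 : k₂ - k₁ ≠ 0 := by linarith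
    have h2 : k₂ + k₁ ≠ 0 := by linarith
    simpa [h1, h2] using this
  refine ⟨ht, isExceptional_of_odd_ratio hk₁ hk₂ (n := n) (l := l) ?_ ?_⟩
  · have : Real.pi * (k₂ * (1 + 2 * n)) = Real.pi * (k₁ * (1 + 2 * l)) := by
      linear_combination k₁ * hl - k₂ * hn
    exact mul_left_cancel₀ Real.pi_ne_zero this
  · have e : ((σ : ℤ) : ℂ) = (-1 : ℂ) ^ (1 + n + l) := by
      have h3 : f k₁ x t * f k₂ x t = ((σ : ℤ) : ℂ) := by
        rw [h₁]; linear_combination -((σ : ℤ) : ℂ) * h₂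
      rw [← h3, hfn, hfl, ← Complex.exp_add, ← Complex.exp_pi_mul_I, ← Complex.exp_int_mul]
      congr 1
      push_cast
      ring
    have e2 : (((σ : ℤ) : ℂ)) = ((((-1 : ℤˣ) ^ (1 + n + l) : ℤˣ) : ℤ) : ℂ) := by
      rw [e]
      rcases Int.even_or_odd (1 + n + l) with he | ho
      · simp [he.neg_one_zpow]
      · simp [ho.neg_one_zpow]
    exact Units.ext (by exact_mod_cast e2)

/-- The zeros of `F(·, t)` are simple, except at time `0` in the exceptional case. -/
theorem exists_hasDerivAt_F {k₁ k₂ : ℝ} (hk₁ : 0 < k₁) (hk₂ : k₁ < k₂) {σ : ℤˣ} {x : ℂ} {t : ℝ}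
    (h : F k₁ k₂ σ x t = 0) (ht : IsExceptional k₁ k₂ σ → t ≠ 0) :
    ∃ d : ℂ, d ≠ 0 ∧ HasDerivAt (fun y => F k₁ k₂ σ y t) d x := by
  obtain ⟨c, hc, hG⟩ := exists_G_eq_zero h
  have hd := (hasDerivAt_G k₁ k₂ σ c x t).mul (hasDerivAt_G k₁ k₂ σ (-c) x t)
  rw [hG, zero_mul, add_zero] at hd
  refine ⟨_, mul_ne_zero (fun h0 => ?_) (fun h0 => ?_),
    hd.congr_of_eventuallyEq (Eventually.of_forall fun y => F_eq_mul k₁ k₂ σ hc y t)⟩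
  · obtain ⟨h1, h2⟩ := f_eq_of_G_eq_zero_of_deriv_eq_zero hk₁ hk₂ hc hG h0
    obtain ⟨h3, h4⟩ := eq_zero_and_isExceptional hk₁ hk₂ h1 h2
    exact ht h4 h3
  · obtain ⟨h1, h2⟩ := f_eq_of_G_eq_zero_of_G_neg_eq_zero hk₁ hk₂ hc hG h0
    obtain ⟨h3, h4⟩ := eq_zero_and_isExceptional hk₁ hk₂ h1 h2
    exact ht h4 h3

/-! ### Poles of `u` -/

theorem differentiable_G (k₁ k₂ : ℝ) (σ : ℤˣ) (c : ℂ) (t : ℝ) :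
    Differentiable ℂ fun y => G k₁ k₂ σ c y t :=
  fun x => (hasDerivAt_G k₁ k₂ σ c x t).differentiableAt

/-- If the factor vanished identically near `z`, so would its derivative, and every nearby point
would be degenerate. Then `f₂² = -1` on an open set, which is impossible for a nonconstant
exponential. -/
theorem eventually_G_ne_zero {k₁ k₂ : ℝ} (hk₁ : 0 < k₁) (hk₂ : k₁ < k₂) (σ : ℤˣ) {c : ℂ}
    (hc : c ^ 2 = -1) (z : ℂ) (t : ℝ) : ∀ᶠ y in 𝓝[≠] z, G k₁ k₂ σ c y t ≠ 0 := by
  refine ((differentiable_G k₁ k₂ σ c t).analyticAt z).eventually_eq_zero_or_eventually_ne_zero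
    |>.resolve_left fun h => ?_
  have h2 : ∀ᶠ y in 𝓝 z, f k₂ y t ^ 2 = -1 := by
    filter_upwards [h.eventually_nhds] with y hy
    have hd : HasDerivAt (fun y => G k₁ k₂ σ c y t) 0 y :=
      (hasDerivAt_const y (0 : ℂ)).congr_of_eventuallyEq hy
    exact (f_eq_of_G_eq_zero_of_deriv_eq_zero hk₁ hk₂ hc hy.self_of_nhds
      ((hasDerivAt_G k₁ k₂ σ c y t).unique hd)).2
  have hd := ((hasDerivAt_const z (-1 : ℂ)).congr_of_eventuallyEq h2).unique
    ((hasDerivAt_f k₂ z t).pow 2)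
  have hk : (k₂ : ℂ) ≠ 0 := by exact_mod_cast (hk₁.trans hk₂).ne'
  simp [f_ne_zero, hk] at hd

theorem eventually_one_sub_ne_zero {k₁ k₂ : ℝ} (hk₁ : 0 < k₁) (hk₂ : k₁ < k₂) (σ : ℤˣ)
    (z : ℂ) (t : ℝ) :
    ∀ᶠ y in 𝓝[≠] z, 1 - ((σ : ℤ) : ℂ) * (f k₁ y t * f k₂ y t) ≠ 0 := by
  have hd : ∀ y, HasDerivAt (fun y => 1 - ((σ : ℤ) : ℂ) * (f k₁ y t * f k₂ y t))
      ((k₁ + k₂) * ((σ : ℤ) : ℂ) * (f k₁ y t * f k₂ y t)) y := fun y =>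
    ((((hasDerivAt_f k₁ y t).mul (hasDerivAt_f k₂ y t)).const_mul ((σ : ℤ) : ℂ)).const_sub
      1).congr_deriv (by ring)
  have hdiff : Differentiable ℂ fun y => 1 - ((σ : ℤ) : ℂ) * (f k₁ y t * f k₂ y t) :=
    fun y => (hd y).differentiableAt
  refine (hdiff.analyticAt z).eventually_eq_zero_or_eventually_ne_zero |>.resolve_left fun h => ?_
  have h0 := (hd z).unique ((hasDerivAt_const z (0 : ℂ)).congr_of_eventuallyEq h)
  have hk : (k₁ : ℂ) + k₂ ≠ 0 := by exact_mod_cast (by linarith : k₁ + k₂ ≠ 0)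
  simp [f_ne_zero, hk] at h0

/-- The identity behind `2 arctan g = -i log((1 + i g)/(1 - i g))` after differentiation, with `g =
-sγp/q`; the coefficient `s` reappears as the sign. -/
theorem two_mul_div_div_eq (s γ p q p' q' : ℂ) {A B : ℂ} (hq : q ≠ 0) (hA : A ≠ 0) (hB : B ≠ 0)
    (hAe : A = q + Complex.I * γ * p) (hBe : B = q - Complex.I * γ * p) :
    2 * ((-s * γ * p' * q - -s * γ * p * q') / q ^ 2) / (A * B / q ^ 2) =
      s * Complex.I * ((q' + Complex.I * γ * p') / A - (q' - Complex.I * γ * p') / B) := by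
  have e : s * Complex.I * ((q' + Complex.I * γ * p') * B - A * (q' - Complex.I * γ * p')) =
      2 * (-s * γ * p' * q - -s * γ * p * q') := by
    rw [hAe, hBe]
    linear_combination (2 * s * γ * (p' * q - p * q')) * Complex.I_sq
  rw [div_sub_div _ _ hA hB, ← mul_div_assoc (s * Complex.I), e]
  field_simp

theorem u_eventuallyEq_logDeriv {k₁ k₂ : ℝ} (hk₁ : 0 < k₁) (hk₂ : k₁ < k₂) (σ : ℤˣ) (z : ℂ)
    (t : ℝ) :
    (fun y => u k₁ k₂ σ y t) =ᶠ[𝓝[≠] z] fun y => ((σ : ℤ) * Complex.I) *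
      logDeriv (fun w => G k₁ k₂ σ Complex.I w t / G k₁ k₂ σ (-Complex.I) w t) y := by
  have hI : (-Complex.I) ^ 2 = -1 := by simp
  filter_upwards [eventually_G_ne_zero hk₁ hk₂ σ Complex.I_sq z t,
    eventually_G_ne_zero hk₁ hk₂ σ hI z t, eventually_one_sub_ne_zero hk₁ hk₂ σ z t]
    with y h₁ h₂ h₃
  have hG₁ := hasDerivAt_G k₁ k₂ σ Complex.I y t
  have hG₂ := hasDerivAt_G k₁ k₂ σ (-Complex.I) y t
  rw [logDeriv_div y h₁ h₂ hG₁.differentiableAt hG₂.differentiableAt, logDeriv_apply,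
    logDeriv_apply, hG₁.deriv, hG₂.deriv]
  have hf₁ := hasDerivAt_f k₁ y t
  have hf₂ := hasDerivAt_f k₂ y t
  have hg := ((hf₁.add (hf₂.const_mul ((σ : ℤ) : ℂ))).const_mul
    (-((σ : ℤ) : ℂ) * (gam k₁ k₂ : ℂ))).div
    (((hf₁.mul hf₂).const_mul ((σ : ℤ) : ℂ)).const_sub 1) h₃
  have hF := F_eq_mul k₁ k₂ σ Complex.I_sq y t
  have hσ := intUnits_cast_sq σ
  have hden : 1 + g k₁ k₂ σ y t ^ 2 = G k₁ k₂ σ Complex.I y t * G k₁ k₂ σ (-Complex.I) y t /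
      (1 - ((σ : ℤ) : ℂ) * (f k₁ y t * f k₂ y t)) ^ 2 := by
    rw [← hF, g, F, eq_div_iff (pow_ne_zero 2 h₃), add_mul, ← mul_pow, div_mul_cancel₀ _ h₃]
    linear_combination (gam k₁ k₂ ^ 2 * (f k₁ y t + ((σ : ℤ) : ℂ) * f k₂ y t) ^ 2 : ℂ) * hσ
  unfold u
  rw [hden]
  have hg' : deriv (fun w => g k₁ k₂ σ w t) y = _ := hg.deriv
  rw [hg']
  refine (two_mul_div_div_eq ((σ : ℤ) : ℂ) (gam k₁ k₂) (f k₁ y t + ((σ : ℤ) : ℂ) * f k₂ y t)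
    _ (-k₁ * f k₁ y t + ((σ : ℤ) : ℂ) * (-k₂ * f k₂ y t))
    (-(((σ : ℤ) : ℂ) * (-k₁ * f k₁ y t * f k₂ y t + f k₁ y t * (-k₂ * f k₂ y t)))) h₃ h₁ h₂
    rfl ?_).trans ?_
  · unfold G
    ring
  · ring

theorem meromorphicOrderAt_G_eq_zero {k₁ k₂ : ℝ} {σ : ℤˣ} {c z : ℂ} {t : ℝ}
    (h : G k₁ k₂ σ c z t ≠ 0) : meromorphicOrderAt (fun y => G k₁ k₂ σ c y t) z = 0 := by
  have ha := (differentiable_G k₁ k₂ σ c t).analyticAt z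
  rw [ha.meromorphicOrderAt_eq, ha.analyticOrderAt_eq_zero.2 h]
  rfl

theorem meromorphicOrderAt_G_ne_zero {k₁ k₂ : ℝ} {σ : ℤˣ} {c z : ℂ} {t : ℝ}
    (h : G k₁ k₂ σ c z t = 0) : meromorphicOrderAt (fun y => G k₁ k₂ σ c y t) z ≠ 0 := by
  have ha := (differentiable_G k₁ k₂ σ c t).analyticAt z
  rw [ha.meromorphicOrderAt_eq]
  have := ha.analyticOrderAt_ne_zero.2 h
  simpa using this

theorem meromorphicOrderAt_G_eq_one_iff {k₁ k₂ : ℝ} {σ : ℤˣ} {c z : ℂ} {t : ℝ}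
    (h : G k₁ k₂ σ c z t = 0) : meromorphicOrderAt (fun y => G k₁ k₂ σ c y t) z = 1 ↔
      deriv (fun y => G k₁ k₂ σ c y t) z ≠ 0 := by
  have ha := (differentiable_G k₁ k₂ σ c t).analyticAt z
  have h1 := ha.analyticOrderAt_deriv_add_one
  simp only [h, sub_zero] at h1
  rw [ha.meromorphicOrderAt_eq, ← ha.deriv.analyticOrderAt_eq_zero, ← h1]
  cases analyticOrderAt (deriv fun y => G k₁ k₂ σ c y t) z with
  | top => simp
  | coe n =>
    change (((n + 1 : ℕ) : ℤ) : WithTop ℤ) = 1 ↔ _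
    norm_cast
    simp

/-- At a zero of `F` the two factors vanish to different orders. -/
theorem meromorphicOrderAt_G_ne {k₁ k₂ : ℝ} (hk₁ : 0 < k₁) (hk₂ : k₁ < k₂) {σ : ℤˣ} {c z : ℂ}
    {t : ℝ} (hc : c ^ 2 = -1) (h : F k₁ k₂ σ z t = 0) :
    meromorphicOrderAt (fun y => G k₁ k₂ σ c y t) z ≠
      meromorphicOrderAt (fun y => G k₁ k₂ σ (-c) y t) z := by
  rw [F_eq_mul k₁ k₂ σ hc] at h
  by_cases h₁ : G k₁ k₂ σ c z t = 0
  · by_cases h₂ : G k₁ k₂ σ (-c) z t = 0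
    · intro he
      have hiff := (meromorphicOrderAt_G_eq_one_iff h₁).symm.trans
        ((by rw [he]) : _ ↔ _) |>.trans (meromorphicOrderAt_G_eq_one_iff h₂)
      obtain ⟨hf₁, hf₂⟩ := f_eq_of_G_eq_zero_of_G_neg_eq_zero hk₁ hk₂ hc h₁ h₂
      have hg := gam_mul hk₂
      have hσ := intUnits_cast_sq σ
      have hks : (k₁ : ℂ) + k₂ ≠ 0 := by exact_mod_cast (by linarith : k₁ + k₂ ≠ 0)
      rw [(hasDerivAt_G k₁ k₂ σ c z t).deriv, (hasDerivAt_G k₁ k₂ σ (-c) z t).deriv, hf₁] at hiff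
      -- At a common zero the two derivatives are `(k₁ + k₂)(1 ∓ cσf₂)` with `(cσf₂)² = 1`. Exactly
      -- one of them vanishes, so exactly one of the factors has order 1.
      have e : ∀ d : ℂ, (k₁ + k₂) * ((σ : ℤ) : ℂ) *
          (-((σ : ℤ) : ℂ) * f k₂ z t * f k₂ z t) - d * gam k₁ k₂ *
          (k₁ * (-((σ : ℤ) : ℂ) * f k₂ z t) + ((σ : ℤ) : ℂ) * (k₂ * f k₂ z t)) =
          (k₁ + k₂) * (1 - d * ((σ : ℤ) : ℂ) * f k₂ z t) := by
        intro d
        linear_combination (-(k₁ + k₂) * f k₂ z t ^ 2 : ℂ) * hσ - (k₁ + k₂ : ℂ) * hf₂ -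
          d * ((σ : ℤ) : ℂ) * f k₂ z t * hg
      rw [e, e, mul_ne_zero_iff, mul_ne_zero_iff] at hiff
      simp only [ne_eq, hks, not_false_eq_true, true_and] at hiff
      have hprod : (1 - c * ((σ : ℤ) : ℂ) * f k₂ z t) * (1 - -c * ((σ : ℤ) : ℂ) * f k₂ z t) = 0 := by
        linear_combination -(((σ : ℤ) : ℂ) ^ 2 * f k₂ z t ^ 2) * hc + f k₂ z t ^ 2 * hσ + hf₂
      have hsum : (1 - c * ((σ : ℤ) : ℂ) * f k₂ z t) + (1 - -c * ((σ : ℤ) : ℂ) * f k₂ z t) = 2 := by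
        ring
      rcases mul_eq_zero.1 hprod with h0 | h0
      · have h0' := not_not.1 (mt hiff.2 (not_not.2 h0))
        rw [h0, h0'] at hsum; norm_num at hsum
      · have h0' := not_not.1 (mt hiff.1 (not_not.2 h0))
        rw [h0, h0'] at hsum; norm_num at hsum
    · rw [meromorphicOrderAt_G_eq_zero h₂]
      exact meromorphicOrderAt_G_ne_zero h₁
  · rw [meromorphicOrderAt_G_eq_zero h₁]
    exact (meromorphicOrderAt_G_ne_zero ((mul_eq_zero.1 h).resolve_left h₁)).symm

theorem meromorphicOrderAt_u_neg_iff {k₁ k₂ : ℝ} (hk₁ : 0 < k₁) (hk₂ : k₁ < k₂) (σ : ℤˣ) (t : ℝ)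
    (z : ℂ) : meromorphicOrderAt (fun y => u k₁ k₂ σ y t) z < 0 ↔ F k₁ k₂ σ z t = 0 := by
  have hI : (-Complex.I) ^ 2 = -1 := by simp
  have hm : ∀ c, MeromorphicAt (fun y => G k₁ k₂ σ c y t) z := fun c =>
    ((differentiable_G k₁ k₂ σ c t).analyticAt z).meromorphicAt
  have htop : ∀ c : ℂ, c ^ 2 = -1 → meromorphicOrderAt (fun y => G k₁ k₂ σ c y t) z ≠ ⊤ :=
    fun c hc => (meromorphicOrderAt_ne_top_iff_eventually_ne_zero (hm c)).2
      (eventually_G_ne_zero hk₁ hk₂ σ hc z t)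
  have hσ : ((σ : ℤ) : ℂ) * Complex.I ≠ 0 := by
    rcases Int.units_eq_one_or σ with rfl | rfl <;> simp
  have hq := (hm Complex.I).fun_div (hm (-Complex.I))
  have hord := fun_meromorphicOrderAt_div (hm Complex.I) (hm (-Complex.I))
  rw [meromorphicOrderAt_congr (u_eventuallyEq_logDeriv hk₁ hk₂ σ z t)]
  have hmul := meromorphicOrderAt_mul_of_ne_zero
    (f := logDeriv fun w => G k₁ k₂ σ Complex.I w t / G k₁ k₂ σ (-Complex.I) w t)
    (analyticAt_const (x := z)) hσ
  change meromorphicOrderAt ((fun _ => ((σ : ℤ) : ℂ) * Complex.I) *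
    logDeriv fun w => G k₁ k₂ σ Complex.I w t / G k₁ k₂ σ (-Complex.I) w t) z < 0 ↔ _
  rw [hmul]
  have h1 := htop _ Complex.I_sq
  have h2 := htop _ hI
  have hne := fun h => meromorphicOrderAt_G_ne (σ := σ) (z := z) (t := t) hk₁ hk₂ Complex.I_sq h
  constructor
  · intro h
    by_contra hF
    rw [F_eq_mul k₁ k₂ σ Complex.I_sq, mul_eq_zero, not_or] at hF
    rw [meromorphicOrderAt_G_eq_zero hF.1, meromorphicOrderAt_G_eq_zero hF.2, sub_zero] at hord
    exact absurd h (not_lt.2 (meromorphicOrderAt_logDeriv_nonneg hq hord))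
  · intro h
    specialize hne h
    lift meromorphicOrderAt (fun y => G k₁ k₂ σ Complex.I y t) z to ℤ using h1 with n
    lift meromorphicOrderAt (fun y => G k₁ k₂ σ (-Complex.I) y t) z to ℤ using h2 with m
    have hnm : n - m ≠ 0 := sub_ne_zero.2 fun e => hne (by rw [e])
    rw [← WithTop.LinearOrderedAddCommGroup.coe_sub] at hord
    rw [meromorphicOrderAt_logDeriv_eq_neg_one hq (by rw [hord]; exact_mod_cast hnm)
      (by rw [hord]; exact WithTop.coe_ne_top)]
    decide

/-! ### Continuation of simple zeros in time -/

/-- Near a simple zero of `Φ(t, ·)`, the zero set of `Φ` is the graph of an analytic function. -/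
theorem exists_local_zero_curve {Φ : ℝ × ℂ → ℂ} {t₀ : ℝ} {z₀ d : ℂ} (hΦ : ContDiff ℝ ω Φ)
    (h0 : Φ (t₀, z₀) = 0) (hd : HasDerivAt (fun z => Φ (t₀, z)) d z₀) (hd0 : d ≠ 0) :
    ∃ ψ : ℝ → ℂ, AnalyticAt ℝ ψ t₀ ∧ ψ t₀ = z₀ ∧
      ∀ᶠ v in 𝓝 (t₀, z₀), Φ v = 0 ↔ ψ v.1 = v.2 := by
  have hc : ContDiffAt ℝ ω Φ (t₀, z₀) := hΦ.contDiffAt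
  have hω : (ω : WithTop ℕ∞) ≠ 0 := by simp
  have hinv : (fderiv ℝ Φ (t₀, z₀) ∘L .inr ℝ ℝ ℂ).IsInvertible := by
    have h1 : HasFDerivAt (fun z => Φ (t₀, z)) (fderiv ℝ Φ (t₀, z₀) ∘L .inr ℝ ℝ ℂ) z₀ :=
      (hc.differentiableAt hω).hasFDerivAt.comp z₀ (hasFDerivAt_prodMk_right t₀ z₀)
    refine ⟨(ContinuousLinearEquiv.unitsEquivAut ℂ (Units.mk0 d hd0)).restrictScalars ℝ, ?_⟩
    rw [h1.unique (hd.hasFDerivAt.restrictScalars ℝ)]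
    ext
    simp
  refine ⟨hc.implicitFunction hω hinv, (hc.contDiffAt_implicitFunction hω hinv).analyticAt,
    hc.implicitFunction_apply_self hω hinv, ?_⟩
  simpa only [h0] using hc.eventually_apply_eq_iff_implicitFunction hω hinv

/-- Simple zeros of an analytic family, confined to a closed set `K` by never meeting its
boundary and locally bounded in time, can be continued along a whole open interval. -/
theorem exists_zero_curve {Φ : ℝ × ℂ → ℂ} {J : Set ℝ} {K : Set ℂ} (hΦ : ContDiff ℝ ω Φ)
    (hJ : J.OrdConnected) (hJo : IsOpen J) (hK : IsClosed K)
    (hint : ∀ t, ∀ z ∈ K, Φ (t, z) = 0 → z ∈ interior K)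
    (hbdd : ∀ T : ℝ, ∃ R : ℝ, ∀ t, |t| ≤ T → ∀ z ∈ K, Φ (t, z) = 0 → ‖z‖ ≤ R)
    (hsimple : ∀ t ∈ J, ∀ z, Φ (t, z) = 0 →
      ∃ d : ℂ, d ≠ 0 ∧ HasDerivAt (fun z => Φ (t, z)) d z)
    {t₀ : ℝ} (ht₀ : t₀ ∈ J) {z₀ : ℂ} (hz₀ : z₀ ∈ K) (h0 : Φ (t₀, z₀) = 0) :
    ∃ x : ℝ → ℂ, AnalyticOnNhd ℝ x J ∧ (∀ t ∈ J, Φ (t, x t) = 0) ∧ x t₀ = z₀ := by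
  let E : Set (ℝ × ℂ) := {v | Φ v = 0 ∧ v.2 ∈ K}
  have hE : IsClosed E := (isClosed_singleton.preimage hΦ.continuous).inter
    (hK.preimage continuous_snd)
  let p : E → ℝ := fun v => v.1.1
  have hp : Continuous p := continuous_fst.comp continuous_subtype_val
  -- Over a compact time set the zeros in `K` form a closed subset of a bounded region.
  have hproper : IsProperMap p := by
    refine isProperMap_iff_isCompact_preimage.2 ⟨hp, fun C hC => ?_⟩
    rw [Subtype.isCompact_iff]
    obtain ⟨T, hT⟩ := hC.isBounded.exists_norm_le
    obtain ⟨R, hR⟩ := hbdd T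
    refine (hC.prod (isCompact_closedBall (0 : ℂ) R)).of_isClosed_subset ?_ ?_
    · have : Subtype.val '' (p ⁻¹' C) = E ∩ Prod.fst ⁻¹' C := by
        ext v
        simp [p, and_comm]
      rw [this]
      exact hE.inter (hC.isClosed.preimage continuous_fst)
    · rintro _ ⟨v, hv, rfl⟩
      exact ⟨hv, mem_closedBall_zero_iff.2 (hR _ (hT _ hv) _ v.2.2 v.2.1)⟩
  have hlocal : IsLocalHomeomorphOn p (p ⁻¹' J) := by
    rintro ⟨⟨t, z⟩, hv⟩ htJ
    obtain ⟨d, hd0, hd⟩ := hsimple t htJ z hv.1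
    obtain ⟨ψ, hψ, hψt, hev⟩ := exists_local_zero_curve hΦ hv.1 hd hd0
    -- Zeros in `K` are interior to `K`, so the local branch given by the implicit function theorem
    -- stays in `E`.
    have hev' : ∀ᶠ v in 𝓝 (t, z), (Φ v = 0 ↔ ψ v.1 = v.2) ∧ v.2 ∈ K :=
      hev.and (continuousAt_snd.eventually (mem_interior_iff_mem_nhds.1 (hint t z hv.2 hv.1)))
    obtain ⟨W, hW, hWo, hWm⟩ := eventually_nhds_iff.1 hev'
    have hcont : ∀ᶠ s in 𝓝 t, ContinuousAt ψ s ∧ (s, ψ s) ∈ W := by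
      refine (hψ.eventually_analyticAt.mono fun s hs => hs.continuousAt).and ?_
      have : ContinuousAt (fun s => (s, ψ s)) t := continuousAt_id.prodMk hψ.continuousAt
      exact this.eventually (by simpa [hψt] using hWo.mem_nhds hWm)
    obtain ⟨I, hI, hIo, hIm⟩ := eventually_nhds_iff.1 hcont
    classical
    have hmem : ∀ s ∈ I, (s, ψ s) ∈ E := fun s hs =>
      ⟨(hW _ (hI s hs).2).1.2 rfl, (hW _ (hI s hs).2).2⟩
    let inv : ℝ → E := fun s => if h : (s, ψ s) ∈ E then ⟨(s, ψ s), h⟩ else ⟨(t, z), hv⟩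
    have hinv : ∀ s ∈ I, (inv s : ℝ × ℂ) = (s, ψ s) := fun s hs => by simp [inv, hmem s hs]
    refine ⟨{ toFun := p, invFun := inv, source := {v | v.1 ∈ W ∧ v.1.1 ∈ I}, target := I,
              map_source' := fun v hv => hv.2,
              map_target' := fun s hs => ?_,
              left_inv' := fun v hv => ?_,
              right_inv' := fun s hs => ?_,
              open_source := ?_,
              open_target := hIo,
              continuousOn_toFun := hp.continuousOn,
              continuousOn_invFun := ?_ }, ⟨hWm, hIm⟩, rfl⟩
    · change (inv s : ℝ × ℂ) ∈ W ∧ (inv s : ℝ × ℂ).1 ∈ I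
      rw [hinv s hs]
      exact ⟨(hI s hs).2, hs⟩
    · apply Subtype.ext
      rw [hinv _ hv.2]
      exact Prod.ext rfl ((hW _ hv.1).1.1 v.2.1)
    · change (inv s : ℝ × ℂ).1 = s
      rw [hinv s hs]
    · rw [Topology.IsInducing.subtypeVal.continuousOn_iff]
      refine ContinuousOn.congr (f := fun s => (s, ψ s)) (fun s hs => ?_) (fun s hs => hinv s hs)
      exact (continuousAt_id.prodMk (hI s hs).1).continuousWithinAt
    · exact (hWo.preimage continuous_subtype_val).inter (hIo.preimage hp)
  have hfin : ∀ t ∈ J, (p ⁻¹' {t}).Finite := fun t ht =>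
    (hproper.isCompact_preimage isCompact_singleton).finite
      (.of_openPartialHomeomorph p subset_rfl fun e he => by
        obtain ⟨φ, hφ, hφp⟩ := hlocal e (by rw [mem_preimage, mem_singleton_iff.1 he]; exact ht)
        exact ⟨φ, hφ, hφp.symm⟩)
  -- A closed local homeomorphism with finite fibres is a covering. The inclusion of the
  -- contractible set `J` into the time axis therefore lifts through the given zero.
  have hcov := hproper.isClosedMap.isCoveringMapOn_of_isLocalHomeomorphOn hfin hlocal
  have hconv : Convex ℝ J := hJ.convex
  have : ContractibleSpace J := hconv.contractibleSpace ⟨t₀, ht₀⟩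
  have : LocallyPathConnectedSpace J := hJo.locallyPathConnectedSpace
  obtain ⟨s, ⟨hs0, hs⟩, -⟩ := hcov.existsUnique_continuousMap_lifts
    (⟨Subtype.val, continuous_subtype_val⟩ : C(J, ℝ)) (a₀ := ⟨t₀, ht₀⟩)
    (e₀ := ⟨(t₀, z₀), h0, hz₀⟩) rfl (fun a => a.2)
  have hs1 : ∀ a : J, (s a : ℝ × ℂ).1 = a := fun a => congrFun hs a
  classical
  let x : ℝ → ℂ := fun t => if h : t ∈ J then (s ⟨t, h⟩ : ℝ × ℂ).2 else 0
  have hx : ∀ a : J, x a = (s a : ℝ × ℂ).2 := fun a => by simp [x]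
  have hx0 : ∀ t ∈ J, Φ (t, x t) = 0 := fun t ht => by
    have := (s ⟨t, ht⟩).2.1
    rwa [← Prod.mk.eta (p := (s ⟨t, ht⟩ : ℝ × ℂ)), hs1, ← hx] at this
  have hxc : ContinuousOn x J := by
    rw [continuousOn_iff_continuous_domRestrict]
    have : J.domRestrict x = fun a => (s a : ℝ × ℂ).2 := funext hx
    rw [this]
    exact continuous_snd.comp (continuous_subtype_val.comp s.continuous)
  refine ⟨x, fun t ht => ?_, hx0, ?_⟩
  · obtain ⟨d, hd0, hd⟩ := hsimple t ht _ (hx0 t ht)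
    obtain ⟨ψ, hψ, -, hev⟩ := exists_local_zero_curve hΦ (hx0 t ht) hd hd0
    have hca : ContinuousAt (fun s => (s, x s)) t :=
      continuousAt_id.prodMk (hxc.continuousAt (hJo.mem_nhds ht))
    refine hψ.congr ?_
    filter_upwards [hca.eventually hev, hJo.mem_nhds ht] with r hr hrJ
    exact hr.1 (hx0 r hrJ)
  · rw [hx ⟨t₀, ht₀⟩, hs0]

/-! ### Confinement of the zeros of `F` -/

theorem contDiff_F (k₁ k₂ : ℝ) (σ : ℤˣ) :
    ContDiff ℝ ω fun v : ℝ × ℂ => F k₁ k₂ σ v.2 v.1 := by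
  have hcast : ContDiff ℝ ω fun v : ℝ × ℂ => (v.1 : ℂ) :=
    Complex.ofRealCLM.contDiff.comp contDiff_fst
  have hf : ∀ k : ℝ, ContDiff ℝ ω fun v : ℝ × ℂ => f k v.2 v.1 := fun k =>
    ((contDiff_const.mul contDiff_snd).add (contDiff_const.mul hcast)).cexp
  unfold F
  have h₁ := hf k₁
  have h₂ := hf k₂
  fun_prop

theorem f_re_im (k : ℝ) (z : ℂ) (t : ℝ) :
    f k z t = Real.exp (-k * z.re + k ^ 3 * t) * Complex.exp ((-(k * z.im) : ℝ) * Complex.I) := by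
  rw [f, Complex.ofReal_exp, ← Complex.exp_add]
  congr 1
  conv_lhs => rw [← Complex.re_add_im z]
  push_cast
  ring

theorem f_re (k : ℝ) (z : ℂ) (t : ℝ) :
    (f k z t).re = Real.exp (-k * z.re + k ^ 3 * t) * Real.cos (k * z.im) := by
  rw [f_re_im, Complex.re_ofReal_mul, Complex.exp_ofReal_mul_I_re, Real.cos_neg]

/-- Horizontal lines on which `f₂` is imaginary, but `f₁` is not, contain no zeros of `F`. -/
theorem F_ne_zero_of_cos {k₁ k₂ : ℝ} (hk₁ : 0 < k₁) (hk₂ : k₁ < k₂) (σ : ℤˣ) {z : ℂ}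
    (h₁ : Real.cos (k₁ * z.im) ≠ 0) (h₂ : Real.cos (k₂ * z.im) = 0) (t : ℝ) :
    F k₁ k₂ σ z t ≠ 0 := by
  intro hF
  obtain ⟨c, hc, hG⟩ := exists_G_eq_zero hF
  rw [G_eq _ _ _ hc] at hG
  have hc' : c = Complex.I ∨ c = -Complex.I := sq_eq_sq_iff_eq_or_eq_neg.1 (by simp [hc])
  have ha : (c * f k₁ z t).im ≠ 0 := by
    have h : (f k₁ z t).re ≠ 0 := by
      rw [f_re]
      exact mul_ne_zero (Real.exp_ne_zero _) h₁
    rcases hc' with rfl | rfl <;> simpa using h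
  have hb : (((σ : ℤ) : ℂ) * c * f k₂ z t).im = 0 := by
    have h : (f k₂ z t).re = 0 := by rw [f_re, h₂, mul_zero]
    rcases hc' with rfl | rfl <;> rcases Int.units_eq_one_or σ with rfl | rfl <;> simpa using h
  generalize c * f k₁ z t = a at hG ha
  generalize ((σ : ℤ) : ℂ) * c * f k₂ z t = b at hG hb
  have him := congrArg Complex.im hG
  have hre := congrArg Complex.re hG
  simp [hb] at him hre
  have hγ := one_lt_gam hk₁ hk₂
  -- With `b` real and `a` not real, the imaginary part forces `b = -γ`; the real part then reads `1
  -- - γ² = 0`, contradicting `γ > 1`.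
  have h0 : a.im * (b.re + gam k₁ k₂) = 0 := by linear_combination him
  have h1 := (mul_eq_zero.1 h0).resolve_left ha
  have h2 : gam k₁ k₂ ^ 2 = 1 := by
    linear_combination -hre + (a.re + gam k₁ k₂) * h1
  nlinarith

/-- Consecutive zeros of `cos (k₂ y)` are `π/k₂` apart. If both were zeros of `cos (k₁ y)`, then
`k₁/k₂` would be an integer strictly between 0 and 1. So one of any two consecutive zeros serves. -/
theorem exists_barrier {k₁ k₂ : ℝ} (hk₁ : 0 < k₁) (hk₂ : k₁ < k₂) (Y : ℝ) :
    ∃ y, Y < y ∧ Real.cos (k₁ * y) ≠ 0 ∧ Real.cos (k₂ * y) = 0 := by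
  have hk₂' : 0 < k₂ := hk₁.trans hk₂
  let y : ℕ → ℝ := fun l => (2 * l + 1) * Real.pi / 2 / k₂
  have hy : ∀ l, Real.cos (k₂ * y l) = 0 := fun l =>
    Real.cos_eq_zero_iff.2 ⟨l, by simp only [y]; field_simp; push_cast; ring⟩
  have hstep : ∀ l, Real.cos (k₁ * y l) ≠ 0 ∨ Real.cos (k₁ * y (l + 1)) ≠ 0 := by
    intro l
    by_contra! h
    obtain ⟨p, hp⟩ := Real.cos_eq_zero_iff.1 h.1
    obtain ⟨q, hq⟩ := Real.cos_eq_zero_iff.1 h.2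
    have e : y (l + 1) - y l = Real.pi / k₂ := by
      simp only [y]; push_cast; field_simp; ring
    have e1 : k₁ / k₂ * Real.pi = (q - p : ℤ) * Real.pi := by
      push_cast
      calc k₁ / k₂ * Real.pi = k₁ * (y (l + 1) - y l) := by rw [e]; ring
        _ = _ := by linear_combination hq - hp
    have e2 : k₁ / k₂ = (q - p : ℤ) := mul_right_cancel₀ Real.pi_ne_zero e1
    have h0 : 0 < k₁ / k₂ := by positivity
    have h1 : k₁ / k₂ < 1 := (div_lt_one hk₂').2 hk₂
    rw [e2] at h0 h1
    have h0' : 0 < q - p := by exact_mod_cast h0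
    have h1' : q - p < 1 := by exact_mod_cast h1
    omega
  obtain ⟨l, hl⟩ := exists_nat_gt (Y * k₂)
  have hlt : ∀ n, l ≤ n → Y < y n := by
    intro n hn
    have hn' : (l : ℝ) ≤ n := by exact_mod_cast hn
    have hpi := Real.two_le_pi
    have hn0 : (0 : ℝ) ≤ n := Nat.cast_nonneg n
    rw [lt_div_iff₀ hk₂']
    nlinarith
  rcases hstep l with h | h
  · exact ⟨y l, hlt _ le_rfl, h, hy l⟩
  · exact ⟨y (l + 1), hlt _ (Nat.le_succ l), h, hy _⟩

theorem norm_intUnits_cast (σ : ℤˣ) : ‖((σ : ℤ) : ℂ)‖ = 1 := by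
  rcases Int.units_eq_one_or σ with rfl | rfl <;> simp

theorem norm_eq_one_of_sq_eq_neg_one {c : ℂ} (hc : c ^ 2 = -1) : ‖c‖ = 1 := by
  have h : ‖c‖ ^ 2 = 1 := by rw [← norm_pow, hc, norm_neg, norm_one]
  exact (pow_eq_one_iff_of_nonneg (norm_nonneg c) two_ne_zero).1 h

/-- Further to the right both `a` and `b` are smaller than `1/(4γ)` in modulus, too small for `ab +
γ(a + b) = -1`. -/
theorem re_le_of_F_eq_zero {k₁ k₂ : ℝ} (hk₁ : 0 < k₁) (hk₂ : k₁ < k₂) {σ : ℤˣ} {z : ℂ} {t T : ℝ}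
    (ht : |t| ≤ T) (hF : F k₁ k₂ σ z t = 0) :
    z.re ≤ k₂ ^ 2 * T + Real.log (4 * gam k₁ k₂) / k₁ := by
  by_contra! hz
  obtain ⟨c, hc, hG⟩ := exists_G_eq_zero hF
  rw [G_eq _ _ _ hc] at hG
  have hγ := one_lt_gam hk₁ hk₂
  set γ := gam k₁ k₂
  have hlog : 0 < Real.log (4 * γ) := Real.log_pos (by linarith)
  have hsmall : ∀ k, k₁ ≤ k → k ≤ k₂ → ‖f k z t‖ < 1 / (4 * γ) := by
    intro k h1 h2
    have hk : 0 < k := hk₁.trans_le h1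
    rw [norm_f, one_div, ← Real.exp_log (by positivity : 0 < (4 * γ)⁻¹), Real.exp_lt_exp,
      Real.log_inv]
    have e1 : Real.log (4 * γ) / k ≤ Real.log (4 * γ) / k₁ := by gcongr
    have e2 : k ^ 2 * t ≤ k₂ ^ 2 * T := by
      have := (le_abs_self t).trans ht
      have hT := (abs_nonneg t).trans ht
      calc k ^ 2 * t ≤ k ^ 2 * T := by gcongr
        _ ≤ _ := by gcongr
    have e3 : k * (k ^ 2 * t + Real.log (4 * γ) / k) < k * z.re :=
      mul_lt_mul_of_pos_left (by linarith) hk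
    have e4 : k * (k ^ 2 * t + Real.log (4 * γ) / k) = k ^ 3 * t + Real.log (4 * γ) := by
      field_simp
    linarith
  have ha : ‖c * f k₁ z t‖ < 1 / (4 * γ) := by
    rw [norm_mul, norm_eq_one_of_sq_eq_neg_one hc, one_mul]
    exact hsmall k₁ le_rfl hk₂.le
  have hb : ‖((σ : ℤ) : ℂ) * c * f k₂ z t‖ < 1 / (4 * γ) := by
    rw [norm_mul, norm_mul, norm_intUnits_cast, norm_eq_one_of_sq_eq_neg_one hc, one_mul, one_mul]
    exact hsmall k₂ hk₂.le le_rfl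
  generalize c * f k₁ z t = a at *
  generalize ((σ : ℤ) : ℂ) * c * f k₂ z t = b at *
  have h1 : (1 : ℝ) ≤ ‖a‖ * ‖b‖ + γ * (‖a‖ + ‖b‖) := by
    have e : (-1 : ℂ) = a * b + γ * (a + b) := by linear_combination -hG
    calc (1 : ℝ) = ‖(-1 : ℂ)‖ := by simp
      _ ≤ ‖a * b‖ + ‖(γ : ℂ) * (a + b)‖ := by rw [e]; exact norm_add_le _ _
      _ ≤ _ := by
        rw [norm_mul, norm_mul, Complex.norm_of_nonneg (by linarith)]
        gcongr
        exact norm_add_le _ _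
  rw [lt_div_iff₀ (by positivity)] at ha hb
  have ha0 := norm_nonneg a
  have hb0 := norm_nonneg b
  nlinarith

/-- The continuation of any zero of `F` for as long as zeros remain simple. -/
theorem exists_isZeroCurve {k₁ k₂ : ℝ} (hk₁ : 0 < k₁) (hk₂ : k₁ < k₂) {σ : ℤˣ} {J : Set ℝ}
    (hJ : J.OrdConnected) (hJo : IsOpen J) (hJ0 : ∀ t ∈ J, IsExceptional k₁ k₂ σ → t ≠ 0)
    {t : ℝ} (ht : t ∈ J) {z : ℂ} (hz : F k₁ k₂ σ z t = 0) :
    ∃ x, IsZeroCurve k₁ k₂ σ J x ∧ x t = z := by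
  obtain ⟨y₁, hy₁, hy₁c, hy₁c'⟩ := exists_barrier hk₁ hk₂ |z.im|
  have hne : ∀ s w, F k₁ k₂ σ w s = 0 → |w.im| ≠ y₁ := by
    intro s w hw he
    refine F_ne_zero_of_cos hk₁ hk₂ σ (z := w) ?_ ?_ s hw
    · rcases abs_choice w.im with h | h <;> rw [h] at he
      · rwa [he]
      · rwa [← Real.cos_neg, ← mul_neg, he]
    · rcases abs_choice w.im with h | h <;> rw [h] at he
      · rwa [he]
      · rwa [← Real.cos_neg, ← mul_neg, he]
  have hcont : Continuous fun w : ℂ => |w.im| := Complex.continuous_im.abs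
  obtain ⟨x, hx, hx0, hxt⟩ := exists_zero_curve (Φ := fun v : ℝ × ℂ => F k₁ k₂ σ v.2 v.1)
    (K := {w : ℂ | |w.im| ≤ y₁}) (contDiff_F k₁ k₂ σ) hJ hJo
    (isClosed_le hcont continuous_const)
    (fun s w hw h => by
      refine interior_mono (s := {w : ℂ | |w.im| < y₁}) (fun v (hv : |v.im| < y₁) => hv.le) ?_
      rw [(isOpen_lt hcont continuous_const).interior_eq]
      exact lt_of_le_of_ne hw (hne s w h))
    (fun T => by
      refine ⟨(k₂ ^ 2 * T + Real.log (4 * gam k₁ k₂) / k₁) + y₁, fun s hs w hw h => ?_⟩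
      have h1 := re_le_of_F_eq_zero hk₁ hk₂ hs h
      -- The lower bound on the real part is the upper bound at the reflected zero.
      have h2 := re_le_of_F_eq_zero hk₁ hk₂ (z := -w) (t := -s) (T := T) (by rwa [abs_neg])
        ((F_neg_neg_eq_zero_iff k₁ k₂ σ w s).2 h)
      rw [Complex.neg_re] at h2
      exact (Complex.norm_le_abs_re_add_abs_im w).trans
        (add_le_add (abs_le.2 ⟨by linarith, h1⟩) hw))
    (fun s hs w hw => exists_hasDerivAt_F hk₁ hk₂ hw (hJ0 s hs)) ht (z₀ := z) hy₁.le hz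
  exact ⟨x, ⟨hx, hx0⟩, hxt⟩

/-! ### Location and separation of the zeros as `t → -∞` -/

theorem f_eq_exp (k : ℝ) (z : ℂ) (t : ℝ) : f k z t = Complex.exp (-(k * (z - k ^ 2 * t))) := by
  rw [f]
  congr 1
  ring

theorem gam_pos {k₁ k₂ : ℝ} (hk₁ : 0 < k₁) (hk₂ : k₁ < k₂) : 0 < gam k₁ k₂ :=
  zero_lt_one.trans (one_lt_gam hk₁ hk₂)

/-- If `c e^{-k(z - k² t - a)}` is close to `-1`, then `z` is close to a soliton pole. -/
theorem exists_norm_sub_solitonPole_le {k a t : ℝ} (hk : 0 < k) {c z v : ℂ} (hc : c ^ 2 = -1)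
    (hv : v = c * Complex.exp (-(k * (z - k ^ 2 * t - a)))) (h : ‖1 + v‖ ≤ 1 / 2) :
    ∃ m : ℤ, Odd m ∧ ‖z - solitonPole k a m t‖ ≤ 3 / 2 * ‖1 + v‖ / k := by
  have hk' : (k : ℂ) ≠ 0 := by exact_mod_cast hk.ne'
  have hv0 : v ≠ 0 := by
    rintro rfl
    norm_num at h
  set ζ := Complex.log (1 + -(1 + v)) with hζ
  have hζn : ‖ζ‖ ≤ 3 / 2 * ‖1 + v‖ := by
    have h1 := Complex.norm_log_one_add_half_le_self (z := -(1 + v)) (by rwa [norm_neg])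
    rwa [norm_neg (1 + v)] at h1
  have hexp : Complex.exp ζ = -v := by
    rw [hζ, Complex.exp_log (by simpa using hv0)]
    ring
  obtain ⟨s, hs, hcs⟩ : ∃ s : ℤ, Odd s ∧ c = Complex.exp (s * (Real.pi / 2 * Complex.I)) := by
    rcases sq_eq_sq_iff_eq_or_eq_neg.1 (by simp [hc] : c ^ 2 = Complex.I ^ 2) with rfl | rfl
    · exact ⟨1, odd_one, by simp [Complex.exp_pi_div_two_mul_I]⟩
    · refine ⟨-1, by decide, ?_⟩
      rw [Complex.exp_int_mul, Complex.exp_pi_div_two_mul_I]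
      simp
  have e : Complex.exp (s * (Real.pi / 2 * Complex.I) + -(k * (z - k ^ 2 * t - a))) =
      Complex.exp (Real.pi * Complex.I + ζ) := by
    rw [Complex.exp_add, ← hcs, ← hv, Complex.exp_add, hexp, Complex.exp_pi_mul_I]
    ring
  obtain ⟨n, hn⟩ := Complex.exp_eq_exp_iff_exists_int.1 e
  -- In units of `πi/2`, `c` contributes `s`, the value `-1` contributes 2 and the periods of the
  -- exponential contribute `4n`.
  refine ⟨s - 2 - 4 * n, ?_, ?_⟩
  · obtain ⟨r, rfl⟩ := hs
    exact ⟨r - 1 - 2 * n, by ring⟩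
  · have e2 : z - solitonPole k a (s - 2 - 4 * n) t = -ζ / k := by
      unfold solitonPole
      rw [eq_div_iff hk']
      push_cast
      field_simp
      linear_combination (-2 : ℂ) * hn
    rw [e2, norm_div, norm_neg, Complex.norm_of_nonneg hk.le]
    gcongr

theorem f_solitonPole_add (k a : ℝ) (hk : 0 < k) (m : ℤ) (t : ℝ) (w : ℂ) :
    f k (solitonPole k a m t + w) t =
      Complex.exp (-(m * (Real.pi / 2 * Complex.I))) * Real.exp (-(k * a)) *
        Complex.exp (-k * w) := by
  have hk' : (k : ℂ) ≠ 0 := by exact_mod_cast hk.ne'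
  rw [f_eq_exp, solitonPole, Complex.ofReal_exp, ← Complex.exp_add, ← Complex.exp_add]
  congr 1
  push_cast
  field_simp
  ring

theorem exp_odd_mul_sq {m : ℤ} (hm : Odd m) :
    Complex.exp (-(m * (Real.pi / 2 * Complex.I))) ^ 2 = -1 := by
  obtain ⟨r, rfl⟩ := hm
  rw [← Complex.exp_nat_mul, ← Complex.exp_pi_mul_I, Complex.exp_eq_exp_iff_exists_int]
  exact ⟨-r - 1, by push_cast; ring⟩

theorem solitonPole_re (k a : ℝ) (m : ℤ) (t : ℝ) :
    (solitonPole k a m t).re = k ^ 2 * t + a := by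
  have h : solitonPole k a m t =
      ((k ^ 2 * t + a : ℝ) : ℂ) + ((m * Real.pi / (2 * k) : ℝ) : ℂ) * Complex.I := by
    unfold solitonPole
    push_cast
    ring
  rw [h, Complex.add_re, Complex.ofReal_re, Complex.re_ofReal_mul, Complex.I_re, mul_zero, add_zero]

theorem norm_f_solitonPole (k l a : ℝ) (m : ℤ) (t : ℝ) :
    ‖f k (solitonPole l a m t) t‖ = Real.exp (k * ((k ^ 2 - l ^ 2) * t - a)) := by
  rw [norm_f, solitonPole_re]
  congr 1
  ring

/-- A perturbation `H(B, ·)` of a function with a simple zero at the origin has exactly one zero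
near the origin. -/
theorem exists_ball_existsUnique_zero {H : ℂ × ℂ → ℂ} {d : ℂ} (hH : ContDiff ℂ ω H)
    (h0 : H (0, 0) = 0) (hd : HasDerivAt (fun w => H (0, w)) d 0) (hd0 : d ≠ 0) :
    ∃ δ₀ > 0, ∀ δ, 0 < δ → δ ≤ δ₀ → ∃ ε > 0, ∀ B : ℂ, ‖B‖ < ε → ∃! w, ‖w‖ < δ ∧ H (B, w) = 0 := by
  have hc : ContDiffAt ℂ ω H (0, 0) := hH.contDiffAt
  have hω : (ω : WithTop ℕ∞) ≠ 0 := by simp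
  have hinv : (fderiv ℂ H (0, 0) ∘L .inr ℂ ℂ ℂ).IsInvertible := by
    have h1 : HasFDerivAt (fun w => H (0, w)) (fderiv ℂ H (0, 0) ∘L .inr ℂ ℂ ℂ) 0 :=
      (hc.differentiableAt hω).hasFDerivAt.comp 0 (hasFDerivAt_prodMk_right 0 0)
    refine ⟨ContinuousLinearEquiv.unitsEquivAut ℂ (Units.mk0 d hd0), ?_⟩
    rw [h1.unique hd.hasFDerivAt]
    ext
    simp
  have hev := hc.eventually_apply_eq_iff_implicitFunction hω hinv
  have hψ0 := hc.implicitFunction_apply_self hω hinv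
  have hψc := (hc.contDiffAt_implicitFunction hω hinv).continuousAt
  generalize hc.implicitFunction hω hinv = ψ at hev hψ0 hψc
  rw [h0, Metric.eventually_nhds_iff] at hev
  obtain ⟨δ₀, hδ₀, hev⟩ := hev
  refine ⟨δ₀, hδ₀, fun δ hδ hδδ => ?_⟩
  obtain ⟨ε₀, hε₀, hψ⟩ := Metric.continuousAt_iff.1 hψc _ hδ
  refine ⟨min ε₀ δ₀, lt_min hε₀ hδ₀, fun B hB => ?_⟩
  have hiff : ∀ w : ℂ, ‖w‖ < δ → (H (B, w) = 0 ↔ ψ B = w) := fun w hw => by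
    refine hev (y := (B, w)) ?_
    rw [Prod.dist_eq, dist_zero_right, dist_zero_right]
    exact max_lt (hB.trans_le (min_le_right _ _)) (hw.trans_le hδδ)
  have hψB : ‖ψ B‖ < δ := by
    have := hψ (x := B) (by simpa using hB.trans_le (min_le_left _ _))
    simpa [hψ0] using this
  exact ⟨ψ B, ⟨hψB, (hiff _ hψB).2 rfl⟩, fun w hw => ((hiff w hw.1).1 hw.2).symm⟩

/-- The asymptotic positions of the zeros as `t → -∞`: the slow soliton for `true`, the fast one
for `false`. -/
noncomputable def pastPole (k₁ k₂ : ℝ) (i : Bool × {m : ℤ // Odd m}) : ℝ → ℂ :=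
  if i.1 then solitonPole k₁ (1 / k₁ * Real.log (gam k₁ k₂)) i.2
  else solitonPole k₂ (-(1 / k₂ * Real.log (gam k₁ k₂))) i.2

theorem continuous_solitonPole (k a : ℝ) (m : ℤ) : Continuous (solitonPole k a m) := by
  unfold solitonPole
  fun_prop

theorem continuous_pastPole (k₁ k₂ : ℝ) (i : Bool × {m : ℤ // Odd m}) :
    Continuous (pastPole k₁ k₂ i) := by
  unfold pastPole
  split_ifs <;> exact continuous_solitonPole _ _ _

/-- A rate at which the interaction of the two solitons decays as `t → -∞`. -/
noncomputable def interaction (k₁ k₂ t : ℝ) : ℝ := Real.exp (k₁ * (k₂ ^ 2 - k₁ ^ 2) / 2 * t)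

theorem tendsto_exp_mul_atBot {κ : ℝ} (hκ : 0 < κ) (b : ℝ) :
    Tendsto (fun t => Real.exp (κ * t + b)) atBot (𝓝 0) :=
  Real.tendsto_exp_atBot.comp (tendsto_atBot_add_const_right _ b (tendsto_id.const_mul_atBot hκ))

theorem sq_sub_sq_pos {k₁ k₂ : ℝ} (hk₁ : 0 < k₁) (hk₂ : k₁ < k₂) : 0 < k₂ ^ 2 - k₁ ^ 2 := by
  nlinarith

theorem tendsto_interaction {k₁ k₂ : ℝ} (hk₁ : 0 < k₁) (hk₂ : k₁ < k₂) :
    Tendsto (interaction k₁ k₂) atBot (𝓝 0) := by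
  have h := sq_sub_sq_pos hk₁ hk₂
  exact (tendsto_exp_mul_atBot (by positivity : 0 < k₁ * (k₂ ^ 2 - k₁ ^ 2) / 2) 0).congr
    fun t => by rw [add_zero, interaction]

/-- The plane is split at the mean velocity `(k₁² + k₂²)/2`: `f₂` is small to the right of that line
and `f₁` is large to the left. -/
theorem norm_f_le_or_le {k₁ k₂ : ℝ} (hk₁ : 0 < k₁) (hk₂ : k₁ < k₂) (z : ℂ) {t : ℝ} (ht : t ≤ 0) :
    ‖f k₂ z t‖ ≤ interaction k₁ k₂ t ∨ 1 ≤ interaction k₁ k₂ t * ‖f k₁ z t‖ := by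
  have h := sq_sub_sq_pos hk₁ hk₂
  rw [norm_f, norm_f, interaction, ← Real.exp_add, Real.exp_le_exp, Real.one_le_exp_iff]
  rcases le_total ((k₁ ^ 2 + k₂ ^ 2) / 2 * t) z.re with hz | hz
  · left
    have h1 := mul_le_mul_of_nonneg_left hz (hk₁.trans hk₂).le
    have h2 : 0 ≤ (k₂ - k₁) * ((k₂ ^ 2 - k₁ ^ 2) / 2 * -t) :=
      mul_nonneg (by linarith) (mul_nonneg (by linarith) (by linarith))
    nlinarith
  · right
    have h1 := mul_le_mul_of_nonneg_left hz hk₁.le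
    nlinarith

/-- As `t → -∞`, all zeros of `F` approach the poles of the two solitons. -/
theorem eventually_exists_pastPole {k₁ k₂ : ℝ} (hk₁ : 0 < k₁) (hk₂ : k₁ < k₂) (σ : ℤˣ) {η : ℝ}
    (hη : 0 < η) : ∀ᶠ t in atBot, ∀ z, F k₁ k₂ σ z t = 0 →
      ∃ i, ‖z - pastPole k₁ k₂ i t‖ < η := by
  have hγ := one_lt_gam hk₁ hk₂
  have hlim := tendsto_interaction hk₁ hk₂
  have hk₂' := hk₁.trans hk₂
  have hlim' : Tendsto (fun t => 2 * (gam k₁ k₂ + 1) * interaction k₁ k₂ t) atBot (𝓝 0) := by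
    simpa using hlim.const_mul (2 * (gam k₁ k₂ + 1))
  filter_upwards [eventually_le_atBot 0,
    hlim'.eventually_lt_const (by norm_num : (0 : ℝ) < 1 / 2),
    hlim'.eventually_lt_const (by positivity : 0 < 2 / 3 * (η * k₁))] with t ht h1 h2 z hz
  obtain ⟨c, hc, hG⟩ := exists_G_eq_zero hz
  rw [G_eq _ _ _ hc] at hG
  have hcn := norm_eq_one_of_sq_eq_neg_one hc
  have hσc : (((σ : ℤ) : ℂ) * c) ^ 2 = -1 := by rw [mul_pow, intUnits_cast_sq, hc, one_mul]
  have hθ : 0 < interaction k₁ k₂ t := Real.exp_pos _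
  have hγC : (gam k₁ k₂ : ℂ) ≠ 0 := gam_ne_zero hk₁ hk₂
  have hγexp : (gam k₁ k₂ : ℂ) = Complex.exp (Real.log (gam k₁ k₂)) := by
    rw [← Complex.ofReal_exp, Real.exp_log (by linarith)]
  have hna : ‖c * f k₁ z t‖ = ‖f k₁ z t‖ := by rw [norm_mul, hcn, one_mul]
  have hnb : ‖((σ : ℤ) : ℂ) * c * f k₂ z t‖ = ‖f k₂ z t‖ := by
    rw [norm_mul, norm_eq_one_of_sq_eq_neg_one hσc, one_mul]
  have key : ∀ (k : ℝ), k₁ ≤ k → ∀ w : ℝ, w ≤ 2 * (gam k₁ k₂ + 1) * interaction k₁ k₂ t →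
      3 / 2 * w / k < η := by
    intro k hk w hw
    rw [div_lt_iff₀ (hk₁.trans_le hk)]
    nlinarith
  rcases norm_f_le_or_le hk₁ hk₂ z ht with h | h
  · rw [← hnb] at h
    have hv : ‖1 + gam k₁ k₂ * (c * f k₁ z t)‖ ≤
        2 * (gam k₁ k₂ + 1) * interaction k₁ k₂ t := by
      generalize c * f k₁ z t = a at *
      generalize ((σ : ℤ) : ℂ) * c * f k₂ z t = b at *
      have hb1 : ‖b‖ ≤ 1 / 4 := by nlinarith
      have hlow : (gam k₁ k₂ - ‖b‖) ≤ ‖(gam k₁ k₂ : ℂ) + b‖ := by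
        have := norm_sub_norm_le (gam k₁ k₂ : ℂ) (-b)
        rwa [sub_neg_eq_add, norm_neg, Complex.norm_of_nonneg (by linarith)] at this
      -- The Möbius relation near `b = 0`, where `a` tends to `-1/γ`. Dividing by `|γ + b| ≥ γ - 1`
      -- gives the constant `γ + 1`.
      have e : (1 + gam k₁ k₂ * a) * (gam k₁ k₂ + b) =
          ((1 - gam k₁ k₂ ^ 2 : ℝ) : ℂ) * b := by
        push_cast; linear_combination gam k₁ k₂ * hG
      have e' := congrArg norm e
      rw [norm_mul, norm_mul, Complex.norm_real, Real.norm_of_nonpos (by nlinarith)] at e'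
      have hN := norm_nonneg (1 + gam k₁ k₂ * a)
      generalize ‖1 + gam k₁ k₂ * a‖ = N at *
      have h3 : (gam k₁ k₂ - 1) * N ≤ (gam k₁ k₂ - 1) * ((gam k₁ k₂ + 1) * ‖b‖) :=
        calc (gam k₁ k₂ - 1) * N = N * (gam k₁ k₂ - 1) := mul_comm _ _
          _ ≤ N * ‖(gam k₁ k₂ : ℂ) + b‖ := mul_le_mul_of_nonneg_left (by linarith) hN
          _ = _ := by rw [e']; ring
      have h4 := le_of_mul_le_mul_left h3 (by linarith)
      have h5 := mul_le_mul_of_nonneg_left h (by linarith : 0 ≤ gam k₁ k₂ + 1)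
      have h6 : 0 < (gam k₁ k₂ + 1) * interaction k₁ k₂ t := by positivity
      linarith
    obtain ⟨m, hm, hle⟩ := exists_norm_sub_solitonPole_le (a := 1 / k₁ * Real.log (gam k₁ k₂))
      (t := t) (z := z) hk₁ hc (v := gam k₁ k₂ * (c * f k₁ z t)) (by
        rw [f_eq_exp, hγexp, mul_left_comm, ← Complex.exp_add]
        congr 2
        have : (k₁ : ℂ) ≠ 0 := by exact_mod_cast hk₁.ne'
        push_cast
        field_simp
        ring) (hv.trans h1.le)
    exact ⟨(true, ⟨m, hm⟩), hle.trans_lt (key k₁ le_rfl _ hv)⟩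
  · rw [← hna] at h
    have hv : ‖1 + (((σ : ℤ) : ℂ) * c * f k₂ z t) / gam k₁ k₂‖ ≤
        2 * (gam k₁ k₂ + 1) * interaction k₁ k₂ t := by
      generalize c * f k₁ z t = a at *
      generalize ((σ : ℤ) : ℂ) * c * f k₂ z t = b at *
      have hlow : ‖a‖ - gam k₁ k₂ ≤ ‖a + (gam k₁ k₂ : ℂ)‖ := by
        have := norm_sub_norm_le a (-(gam k₁ k₂ : ℂ))
        rwa [sub_neg_eq_add, norm_neg, Complex.norm_of_nonneg (by linarith)] at this
      -- The same relation near `a = ∞`, where `b` tends to `-γ`. Here `|a + γ| ≥ |a|/2`, because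
      -- `|a| ≥ 4(γ + 1)`.
      have e : (1 + b / gam k₁ k₂) * (a + gam k₁ k₂) * gam k₁ k₂ =
          ((gam k₁ k₂ ^ 2 - 1 : ℝ) : ℂ) := by
        push_cast
        field_simp
        linear_combination hG
      have e' := congrArg norm e
      rw [norm_mul, norm_mul, Complex.norm_real, Complex.norm_real,
        Real.norm_of_nonneg (by linarith), Real.norm_of_nonneg (by nlinarith)] at e'
      have hN := norm_nonneg (1 + b / gam k₁ k₂)
      generalize ‖1 + b / gam k₁ k₂‖ = N at *
      have ha : 4 * (gam k₁ k₂ + 1) ≤ ‖a‖ := by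
        refine le_of_mul_le_mul_left (le_trans ?_ h) hθ
        linarith
      have h3 : gam k₁ k₂ * (N * ‖a‖) ≤ gam k₁ k₂ * (2 * (gam k₁ k₂ + 1)) :=
        calc gam k₁ k₂ * (N * ‖a‖) = 2 * (N * (‖a‖ / 2) * gam k₁ k₂) := by ring
          _ ≤ 2 * (N * ‖a + (gam k₁ k₂ : ℂ)‖ * gam k₁ k₂) := by
            gcongr
            linarith
          _ ≤ _ := by
            rw [e']
            nlinarith
      have h4 := le_of_mul_le_mul_left h3 (by linarith)
      calc N ≤ N * (interaction k₁ k₂ t * ‖a‖) := le_mul_of_one_le_right hN h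
        _ = N * ‖a‖ * interaction k₁ k₂ t := by ring
        _ ≤ _ := by gcongr
    obtain ⟨m, hm, hle⟩ := exists_norm_sub_solitonPole_le (a := -(1 / k₂ * Real.log (gam k₁ k₂)))
      (t := t) (z := z) hk₂' hσc (v := ((σ : ℤ) : ℂ) * c * f k₂ z t / gam k₁ k₂) (by
        rw [f_eq_exp, hγexp, mul_div_assoc, ← Complex.exp_sub]
        congr 2
        have : (k₂ : ℂ) ≠ 0 := by exact_mod_cast hk₂'.ne'
        push_cast
        field_simp
        ring) (hv.trans h1.le)
    exact ⟨(false, ⟨m, hm⟩), hle.trans_lt (key k₂ hk₂.le _ hv)⟩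

/-- The soliton poles stay apart as `t → -∞`. -/
theorem exists_eventually_separated {k₁ k₂ : ℝ} (hk₁ : 0 < k₁) (hk₂ : k₁ < k₂) :
    ∃ s > 0, ∀ᶠ t in atBot, ∀ i j, i ≠ j →
      s ≤ ‖pastPole k₁ k₂ i t - pastPole k₁ k₂ j t‖ := by
  have hk₂' := hk₁.trans hk₂
  have hsame : ∀ (k a t : ℝ) (m n : ℤ), k₁ ≤ k → k ≤ k₂ → m ≠ n →
      1 / (2 * k₂) ≤ ‖solitonPole k a m t - solitonPole k a n t‖ := by
    intro k a t m n hk hk' hmn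
    have hk0 := hk₁.trans_le hk
    have e : solitonPole k a m t - solitonPole k a n t =
        (((m - n : ℤ) * Real.pi / (2 * k) : ℝ) : ℂ) * Complex.I := by
      unfold solitonPole
      push_cast
      ring
    have h1 : (1 : ℝ) ≤ |((m - n : ℤ) : ℝ)| := by
      exact_mod_cast Int.one_le_abs (sub_ne_zero.2 hmn)
    rw [e, norm_mul, Complex.norm_I, mul_one, Complex.norm_real, Real.norm_eq_abs, abs_div,
      abs_mul, abs_of_pos Real.pi_pos, abs_of_pos (by positivity : 0 < 2 * k)]
    have hpi := Real.two_le_pi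
    gcongr
    nlinarith
  -- Poles of different solitons are separated by their real parts: for negative `t` the slow
  -- soliton is to the right, and both phase shifts widen the gap.
  have hdiff : ∀ t, t ≤ -(1 / (2 * k₂)) / (k₂ ^ 2 - k₁ ^ 2) → ∀ m n : ℤ, 1 / (2 * k₂) ≤
      ‖solitonPole k₁ (1 / k₁ * Real.log (gam k₁ k₂)) m t -
        solitonPole k₂ (-(1 / k₂ * Real.log (gam k₁ k₂))) n t‖ := by
    intro t ht m n
    refine le_trans ?_ (Complex.re_le_norm _)
    rw [Complex.sub_re, solitonPole_re, solitonPole_re]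
    have hlog : 0 < Real.log (gam k₁ k₂) := Real.log_pos (one_lt_gam hk₁ hk₂)
    rw [le_div_iff₀ (sq_sub_sq_pos hk₁ hk₂)] at ht
    have h1 : 0 < 1 / k₁ * Real.log (gam k₁ k₂) := by positivity
    have h2 : 0 < 1 / k₂ * Real.log (gam k₁ k₂) := by positivity
    linarith
  refine ⟨1 / (2 * k₂), by positivity, ?_⟩
  filter_upwards [eventually_le_atBot (-(1 / (2 * k₂)) / (k₂ ^ 2 - k₁ ^ 2))] with t ht
  rintro ⟨i, m, hm⟩ ⟨j, n, hn⟩ hne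
  cases i <;> cases j
  · exact hsame _ _ _ _ _ hk₂.le le_rfl (by rintro rfl; exact hne rfl)
  · rw [norm_sub_rev]
    exact hdiff t ht n m
  · exact hdiff t ht m n
  · exact hsame _ _ _ _ _ le_rfl hk₂.le (by rintro rfl; exact hne rfl)

/-- A continuous path near a family of separated paths follows one of them. -/
theorem asympTo_of_separated {ι : Type*} {P : ι → ℝ → ℂ} {x : ℝ → ℂ} {T δ : ℝ}
    (hP : ∀ i, Continuous (P i)) (hx : ContinuousOn x (Iio T))
    (hsep : ∀ t < T, ∀ i j, i ≠ j → 2 * δ ≤ ‖P i t - P j t‖)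
    (hloc : ∀ η > 0, ∀ᶠ t in atBot, ∃ i, ‖x t - P i t‖ < η)
    (hδ : ∀ t < T, ∃ i, ‖x t - P i t‖ < δ) {i : ι} {t₁ : ℝ} (ht₁ : t₁ < T)
    (h₁ : ‖x t₁ - P i t₁‖ < δ) : AsympTo atBot x (P i) := by
  have huniq : ∀ t < T, ∀ i j, ‖x t - P i t‖ < δ → ‖x t - P j t‖ < δ → i = j := by
    intro t ht i j hi hj
    by_contra hne
    have h1 := hsep t ht i j hne
    have h2 := norm_sub_le (x t - P j t) (x t - P i t)
    rw [sub_sub_sub_cancel_left] at h2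
    linarith
  have hopen : ∀ j, IsOpen (Iio T ∩ {t | ‖x t - P j t‖ < δ}) := fun j =>
    (hx.sub (hP j).continuousOn).norm.isOpen_inter_preimage isOpen_Iio isOpen_Iio
  -- The sets of times near each path are open, disjoint and cover the ray, so by connectedness one
  -- of them is the whole ray.
  have hsub : Iio T ⊆ Iio T ∩ {t | ‖x t - P i t‖ < δ} := by
    refine isPreconnected_Iio.subset_left_of_subset_union (hopen i)
      (isOpen_iUnion fun j : {j // j ≠ i} => hopen j) ?_ ?_ ⟨t₁, ht₁, ht₁, h₁⟩
    · rw [disjoint_iUnion_right]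
      rintro ⟨j, hj⟩
      rw [Set.disjoint_left]
      exact fun t hi hj' => hj (huniq t hi.1 _ _ hj'.2 hi.2)
    · intro t ht
      obtain ⟨j, hj⟩ := hδ t ht
      by_cases hji : j = i
      · exact Or.inl ⟨ht, hji ▸ hj⟩
      · exact Or.inr (mem_iUnion.2 ⟨⟨j, hji⟩, ht, hj⟩)
  refine tendsto_zero_iff_norm_tendsto_zero.2 (Metric.tendsto_nhds.2 fun η hη => ?_)
  have hδ0 : 0 < δ := (norm_nonneg _).trans_lt h₁
  filter_upwards [hloc _ (lt_min hη hδ0), eventually_lt_atBot T] with t ⟨j, hj⟩ ht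
  have hji := huniq t ht _ _ (hj.trans_le (min_le_right _ _)) (hsub ht).2
  rw [← hji, dist_zero_right, norm_norm]
  exact hj.trans_le (min_le_left _ _)

/-! ### Exactly one zero near each soliton pole -/

theorem existsUnique_translate {p : ℂ → Prop} {δ : ℝ} (P : ℂ) (h : ∃! w, ‖w‖ < δ ∧ p (P + w)) :
    ∃! z, ‖z - P‖ < δ ∧ p z := by
  obtain ⟨w, hw, huniq⟩ := h
  refine ⟨P + w, by simpa using hw, fun z hz => ?_⟩
  have := huniq (z - P) (by simpa using hz)
  rw [← this]
  ring

/-- As `t → -∞`, there is exactly one zero of `F` near each pole of the slow soliton. -/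
theorem exists_existsUnique_near_slow {k₁ k₂ : ℝ} (hk₁ : 0 < k₁) (hk₂ : k₁ < k₂) (σ : ℤˣ) :
    ∃ δ₀ > 0, ∀ δ, 0 < δ → δ ≤ δ₀ → ∀ᶠ t in atBot, ∀ m : ℤ, Odd m →
      ∃! z, ‖z - solitonPole k₁ (1 / k₁ * Real.log (gam k₁ k₂)) m t‖ < δ ∧
        F k₁ k₂ σ z t = 0 := by
  have hγ := gam_pos hk₁ hk₂
  -- `H (B, w)` is `F` at `P + w`, where `P` is the slow pole and `B = -cσ f₂(P)` tends to 0. At `B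
  -- = 0` it is `1 - exp(-2k₁w)`, with a simple zero at the origin. As `|B|` does not depend on `m`,
  -- one threshold in time serves all poles.
  let H : ℂ × ℂ → ℂ := fun v =>
    (1 + Complex.exp (-k₁ * v.2) * v.1 * Complex.exp (-k₂ * v.2) * (gam k₁ k₂ : ℂ)⁻¹) ^ 2 -
      (Complex.exp (-k₁ * v.2) + gam k₁ k₂ * v.1 * Complex.exp (-k₂ * v.2)) ^ 2
  have hexp : ∀ k : ℂ, ContDiff ℂ ω fun v : ℂ × ℂ => Complex.exp (k * v.2) := fun k =>
    (contDiff_const.mul contDiff_snd).cexp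
  have hH : ContDiff ℂ ω H := by
    have h1 := hexp (-k₁)
    have h2 := hexp (-k₂)
    fun_prop
  have hH0 : (fun w => H (0, w)) = fun w => 1 - Complex.exp (-k₁ * w) ^ 2 := by
    funext w
    simp [H]
  have hd : HasDerivAt (fun w => H (0, w)) (2 * k₁) 0 := by
    rw [hH0]
    exact ((((hasDerivAt_id (0 : ℂ)).const_mul (-(k₁ : ℂ))).cexp.pow 2).const_sub 1).congr_deriv
      (by simp)
  have hk₁' : (2 * k₁ : ℂ) ≠ 0 := by exact_mod_cast (by positivity : 2 * k₁ ≠ 0)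
  obtain ⟨δ₀, hδ₀, hδ⟩ := exists_ball_existsUnique_zero hH (by simp [H]) hd hk₁'
  refine ⟨δ₀, hδ₀, fun δ h0 hle => ?_⟩
  obtain ⟨ε, hε, hex⟩ := hδ δ h0 hle
  have hlim := tendsto_exp_mul_atBot (mul_pos (hk₁.trans hk₂) (sq_sub_sq_pos hk₁ hk₂))
    (-(k₂ * (1 / k₁ * Real.log (gam k₁ k₂))))
  filter_upwards [hlim.eventually_lt_const hε] with t ht m hm
  set P := solitonPole k₁ (1 / k₁ * Real.log (gam k₁ k₂)) m t
  set c := Complex.exp (-(m * (Real.pi / 2 * Complex.I)))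
  have hc : c ^ 2 = -1 := exp_odd_mul_sq hm
  have hB : ‖-(c * ((σ : ℤ) : ℂ) * f k₂ P t)‖ < ε := by
    rw [norm_neg, norm_mul, norm_mul, norm_eq_one_of_sq_eq_neg_one hc, norm_intUnits_cast, one_mul,
      one_mul, norm_f_solitonPole]
    exact (congrArg Real.exp (by ring)).trans_lt ht
  refine existsUnique_translate P ?_
  convert hex _ hB using 5 with w
  have hf₁ : f k₁ (P + w) t = c * (gam k₁ k₂ : ℂ)⁻¹ * Complex.exp (-k₁ * w) := by
    rw [f_solitonPole_add _ _ hk₁]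
    have : Real.exp (-(k₁ * (1 / k₁ * Real.log (gam k₁ k₂)))) = (gam k₁ k₂)⁻¹ := by
      rw [← mul_assoc, mul_one_div_cancel hk₁.ne', one_mul, Real.exp_neg, Real.exp_log hγ]
    rw [this, Complex.ofReal_inv]
  have hγC : (gam k₁ k₂ : ℂ) * (gam k₁ k₂ : ℂ)⁻¹ = 1 := mul_inv_cancel₀ (gam_ne_zero hk₁ hk₂)
  simp only [F, H]
  rw [f_add k₂, hf₁]
  generalize f k₂ P t = β
  generalize Complex.exp (-k₁ * w) = E₁
  generalize Complex.exp (-k₂ * w) = E₂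
  generalize (gam k₁ k₂ : ℂ)⁻¹ = γ' at *
  generalize (gam k₁ k₂ : ℂ) = γ at *
  generalize ((σ : ℤ) : ℂ) = s at *
  have e1 : 1 + E₁ * -(c * s * β) * E₂ * γ' = 1 - s * (c * γ' * E₁ * (β * E₂)) := by ring
  have e2 : γ ^ 2 * (c * γ' * E₁ + s * (β * E₂)) ^ 2 =
      -(E₁ + γ * -(c * s * β) * E₂) ^ 2 := by
    have e3 : γ * (c * γ' * E₁ + s * (β * E₂)) = c * (E₁ + γ * -(c * s * β) * E₂) := by
      linear_combination c * E₁ * hγC + γ * s * β * E₂ * hc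
    rw [← mul_pow, e3, mul_pow, hc]
    ring
  rw [e1, e2, ← sub_eq_add_neg]

/-- As `t → -∞`, there is exactly one zero of `F` near each pole of the fast soliton. -/
theorem exists_existsUnique_near_fast {k₁ k₂ : ℝ} (hk₁ : 0 < k₁) (hk₂ : k₁ < k₂) (σ : ℤˣ) :
    ∃ δ₀ > 0, ∀ δ, 0 < δ → δ ≤ δ₀ → ∀ᶠ t in atBot, ∀ m : ℤ, Odd m →
      ∃! z, ‖z - solitonPole k₂ (-(1 / k₂ * Real.log (gam k₁ k₂))) m t‖ < δ ∧
        F k₁ k₂ σ z t = 0 := by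
  have hγ := gam_pos hk₁ hk₂
  have hk₂p := hk₁.trans hk₂
  -- Near a fast pole `f₁` is large, so `F` is divided by `f₁²` and the small parameter is `B = -cσ
  -- / f₁(P)`. At `B = 0` this leaves `γ²(1 - exp(-2k₂w))`.
  let H : ℂ × ℂ → ℂ := fun v =>
    (gam k₁ k₂ : ℂ) ^ 2 *
      (1 - gam k₁ k₂ * Complex.exp (-k₂ * v.2) * (v.1 * Complex.exp (k₁ * v.2))) ^ 2 -
      (v.1 * Complex.exp (k₁ * v.2) - gam k₁ k₂ * Complex.exp (-k₂ * v.2)) ^ 2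
  have hexp : ∀ k : ℂ, ContDiff ℂ ω fun v : ℂ × ℂ => Complex.exp (k * v.2) := fun k =>
    (contDiff_const.mul contDiff_snd).cexp
  have hH : ContDiff ℂ ω H := by
    have h1 := hexp k₁
    have h2 := hexp (-k₂)
    fun_prop
  have hH0 : (fun w => H (0, w)) = fun w =>
      (gam k₁ k₂ : ℂ) ^ 2 - (gam k₁ k₂ * Complex.exp (-k₂ * w)) ^ 2 := by
    funext w
    simp [H]
  have hd : HasDerivAt (fun w => H (0, w)) (2 * (gam k₁ k₂ : ℂ) ^ 2 * k₂) 0 := by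
    rw [hH0]
    exact (((((hasDerivAt_id (0 : ℂ)).const_mul (-(k₂ : ℂ))).cexp.const_mul
      (gam k₁ k₂ : ℂ)).pow 2).const_sub ((gam k₁ k₂ : ℂ) ^ 2)).congr_deriv (by simp; ring)
  have hd0 : (2 * (gam k₁ k₂ : ℂ) ^ 2 * k₂ : ℂ) ≠ 0 := by
    exact_mod_cast (by positivity : 2 * gam k₁ k₂ ^ 2 * k₂ ≠ 0)
  obtain ⟨δ₀, hδ₀, hδ⟩ := exists_ball_existsUnique_zero hH (by simp [H]) hd hd0
  refine ⟨δ₀, hδ₀, fun δ h0 hle => ?_⟩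
  obtain ⟨ε, hε, hex⟩ := hδ δ h0 hle
  have hlim := tendsto_exp_mul_atBot (mul_pos hk₁ (sq_sub_sq_pos hk₁ hk₂))
    (-(k₁ * (1 / k₂ * Real.log (gam k₁ k₂))))
  filter_upwards [hlim.eventually_lt_const hε] with t ht m hm
  set P := solitonPole k₂ (-(1 / k₂ * Real.log (gam k₁ k₂))) m t
  set c := Complex.exp (-(m * (Real.pi / 2 * Complex.I)))
  have hc : c ^ 2 = -1 := exp_odd_mul_sq hm
  have hB : ‖-(c * ((σ : ℤ) : ℂ) * (f k₁ P t)⁻¹)‖ < ε := by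
    rw [norm_neg, norm_mul, norm_mul, norm_eq_one_of_sq_eq_neg_one hc, norm_intUnits_cast, one_mul,
      one_mul, norm_inv, norm_f_solitonPole, ← Real.exp_neg]
    exact (congrArg Real.exp (by ring)).trans_lt ht
  refine existsUnique_translate P ?_
  refine (existsUnique_congr fun w => and_congr_right fun _ => ?_).2 (hex _ hB)
  have hf₂ : f k₂ (P + w) t = c * gam k₁ k₂ * Complex.exp (-k₂ * w) := by
    rw [f_solitonPole_add _ _ hk₂p]
    have : Real.exp (-(k₂ * -(1 / k₂ * Real.log (gam k₁ k₂)))) = gam k₁ k₂ := by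
      rw [mul_neg, neg_neg, ← mul_assoc, mul_one_div_cancel hk₂p.ne', one_mul, Real.exp_log hγ]
    rw [this]
  have hσ := intUnits_cast_sq σ
  have hα0 := f_ne_zero k₁ P t
  have hα : f k₁ P t * (f k₁ P t)⁻¹ = 1 := mul_inv_cancel₀ hα0
  have hE : Complex.exp (-k₁ * w) * Complex.exp (k₁ * w) = 1 := by
    rw [← Complex.exp_add]
    simp
  have hE0 : Complex.exp (-k₁ * w) ≠ 0 := Complex.exp_ne_zero _
  simp only [F, H]
  rw [f_add k₁, hf₂]
  generalize (f k₁ P t)⁻¹ = α' at *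
  generalize f k₁ P t = α at *
  generalize Complex.exp (-k₁ * w) = E₁ at *
  generalize Complex.exp (k₁ * w) = E₁' at *
  generalize Complex.exp (-k₂ * w) = E₂
  generalize (gam k₁ k₂ : ℂ) = γ at *
  generalize ((σ : ℤ) : ℂ) = s at *
  have hinv : α * E₁ * (α' * E₁') = 1 := by
    linear_combination α * α' * hE + hα
  have e1 : 1 - s * (α * E₁ * (c * γ * E₂)) =
      α * E₁ * (s * c) * (-(c * s * α') * E₁' - γ * E₂) := by
    linear_combination (-1 : ℂ) * hinv + α * E₁ * α' * E₁' * s ^ 2 * hc -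
      α * E₁ * α' * E₁' * hσ
  have e2 : α * E₁ + s * (c * γ * E₂) =
      α * E₁ * (1 - γ * E₂ * (-(c * s * α') * E₁')) := by
    linear_combination (-(c * s * γ * E₂)) * hinv
  have e3 : (s * c) ^ 2 = -1 := by rw [mul_pow, hσ, hc, one_mul]
  have e4 : (1 - s * (α * E₁ * (c * γ * E₂))) ^ 2 + γ ^ 2 * (α * E₁ + s * (c * γ * E₂)) ^ 2 =
      (α * E₁) ^ 2 * (γ ^ 2 * (1 - γ * E₂ * (-(c * s * α') * E₁')) ^ 2 -
        (-(c * s * α') * E₁' - γ * E₂) ^ 2) := by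
    rw [e1, e2]
    linear_combination ((α * E₁) ^ 2 * (-(c * s * α') * E₁' - γ * E₂) ^ 2) * e3
  rw [e4, mul_eq_zero, or_iff_right (pow_ne_zero 2 (mul_ne_zero hα0 hE0))]

/-! ### Curves of zeros as `t → -∞` -/

theorem isOpen_pastTimes (k₁ k₂ : ℝ) (σ : ℤˣ) : IsOpen (pastTimes k₁ k₂ σ) := by
  by_cases h : IsExceptional k₁ k₂ σ
  · rw [show pastTimes k₁ k₂ σ = Iio 0 by ext t; simp [pastTimes, h]]
    exact isOpen_Iio
  · simp [pastTimes, h]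

theorem ordConnected_pastTimes (k₁ k₂ : ℝ) (σ : ℤˣ) : (pastTimes k₁ k₂ σ).OrdConnected :=
  IsLowerSet.ordConnected fun _ _ hba ha h => hba.trans_lt (ha h)

theorem Iio_zero_subset_pastTimes (k₁ k₂ : ℝ) (σ : ℤˣ) : Iio 0 ⊆ pastTimes k₁ k₂ σ :=
  fun _ ht _ => ht

theorem exists_isZeroCurve_past {k₁ k₂ : ℝ} (hk₁ : 0 < k₁) (hk₂ : k₁ < k₂) {σ : ℤˣ} {t : ℝ}
    (ht : t ∈ pastTimes k₁ k₂ σ) {z : ℂ} (hz : F k₁ k₂ σ z t = 0) :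
    ∃ x, IsZeroCurve k₁ k₂ σ (pastTimes k₁ k₂ σ) x ∧ x t = z :=
  exists_isZeroCurve hk₁ hk₂ (ordConnected_pastTimes k₁ k₂ σ) (isOpen_pastTimes k₁ k₂ σ)
    (fun _ hs h => (hs h).ne) ht hz

/-- Proximity to a pole at a single early time decides the asymptotics, since the curve cannot
switch poles. -/
theorem IsZeroCurve.asympTo_of_near {k₁ k₂ : ℝ} (hk₁ : 0 < k₁) (hk₂ : k₁ < k₂) {σ : ℤˣ}
    {x : ℝ → ℂ} (hx : IsZeroCurve k₁ k₂ σ (pastTimes k₁ k₂ σ) x) {T δ : ℝ} (hT : T ≤ 0)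
    (hsep : ∀ t < T, ∀ i j, i ≠ j → 2 * δ ≤ ‖pastPole k₁ k₂ i t - pastPole k₁ k₂ j t‖)
    (hδ : ∀ t < T, ∀ z, F k₁ k₂ σ z t = 0 → ∃ i, ‖z - pastPole k₁ k₂ i t‖ < δ)
    {i : Bool × {m : ℤ // Odd m}} {t₁ : ℝ} (ht₁ : t₁ < T)
    (h₁ : ‖x t₁ - pastPole k₁ k₂ i t₁‖ < δ) : AsympTo atBot x (pastPole k₁ k₂ i) := by
  have hmem : ∀ t < T, t ∈ pastTimes k₁ k₂ σ := fun t ht =>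
    Iio_zero_subset_pastTimes k₁ k₂ σ (ht.trans_le hT)
  refine asympTo_of_separated (continuous_pastPole k₁ k₂)
    (hx.1.continuousOn.mono fun t ht => hmem t ht) hsep (fun η hη => ?_)
    (fun t ht => hδ t ht _ (hx.2 t (hmem t ht))) ht₁ h₁
  filter_upwards [eventually_exists_pastPole hk₁ hk₂ σ hη, eventually_lt_atBot T] with t h ht
  exact h _ (hx.2 t (hmem t ht))

/-- A common description of all zeros of `F` for large negative times. -/
theorem exists_past_description {k₁ k₂ : ℝ} (hk₁ : 0 < k₁) (hk₂ : k₁ < k₂) (σ : ℤˣ) :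
    ∃ δ > 0, ∃ T ≤ 0,
      (∀ t < T, ∀ i j, i ≠ j → 2 * δ ≤ ‖pastPole k₁ k₂ i t - pastPole k₁ k₂ j t‖) ∧
      (∀ t < T, ∀ z, F k₁ k₂ σ z t = 0 → ∃ i, ‖z - pastPole k₁ k₂ i t‖ < δ) ∧
      (∀ t < T, ∀ i, ∃! z, ‖z - pastPole k₁ k₂ i t‖ < δ ∧ F k₁ k₂ σ z t = 0) := by
  obtain ⟨s, hs, hsep⟩ := exists_eventually_separated hk₁ hk₂
  obtain ⟨δ₁, hδ₁, hslow⟩ := exists_existsUnique_near_slow hk₁ hk₂ σ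
  obtain ⟨δ₂, hδ₂, hfast⟩ := exists_existsUnique_near_fast hk₁ hk₂ σ
  have hδ : 0 < min (s / 2) (min δ₁ δ₂) := by positivity
  refine ⟨_, hδ, ?_⟩
  have h1 := hslow _ hδ ((min_le_right _ _).trans (min_le_left _ _))
  have h2 := hfast _ hδ ((min_le_right _ _).trans (min_le_right _ _))
  obtain ⟨T, hT⟩ := eventually_atBot.1 (hsep.and ((eventually_exists_pastPole hk₁ hk₂ σ hδ).and
    (h1.and h2)))
  refine ⟨min T 0, min_le_right _ _, fun t ht i j hij => ?_, fun t ht => ?_, fun t ht => ?_⟩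
  · have := (hT t (ht.le.trans (min_le_left _ _))).1 i j hij
    have h3 := min_le_left (s / 2) (min δ₁ δ₂)
    linarith
  · exact (hT t (ht.le.trans (min_le_left _ _))).2.1
  · rintro ⟨i, m, hm⟩
    have := (hT t (ht.le.trans (min_le_left _ _))).2.2
    cases i
    · exact this.2 m hm
    · exact this.1 m hm

/-- Existence continues the zero found near the pole at one early time. Two curves with the same
asymptotics both enter the disc that holds only one zero, so they agree at early times, hence
everywhere by the identity theorem on the interval. -/
theorem existsUniqueZeroCurve_past {k₁ k₂ : ℝ} (hk₁ : 0 < k₁) (hk₂ : k₁ < k₂) (σ : ℤˣ)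
    (i : Bool × {m : ℤ // Odd m}) :
    ExistsUniqueZeroCurve k₁ k₂ σ (pastTimes k₁ k₂ σ) atBot (pastPole k₁ k₂ i) := by
  obtain ⟨δ, hδ, T, hT, hsep, hloc, huniq⟩ := exists_past_description hk₁ hk₂ σ
  have ht : T - 1 < T := by linarith
  have hmem : ∀ t < T, t ∈ pastTimes k₁ k₂ σ := fun t ht =>
    Iio_zero_subset_pastTimes k₁ k₂ σ (ht.trans_le hT)
  obtain ⟨z, ⟨hz, hFz⟩, -⟩ := huniq _ ht i
  obtain ⟨x, hx, hxt⟩ := exists_isZeroCurve_past hk₁ hk₂ (hmem _ ht) hFz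
  have hxa := hx.asympTo_of_near hk₁ hk₂ hT hsep hloc ht (i := i) (by rwa [hxt])
  refine ⟨x, ⟨hx, hxa⟩, fun x' hx' hxa' => ?_⟩
  have near : ∀ {y : ℝ → ℂ}, AsympTo atBot y (pastPole k₁ k₂ i) →
      ∀ᶠ t in atBot, ‖y t - pastPole k₁ k₂ i t‖ < δ := fun hy => by
    simpa using (Metric.tendsto_nhds.1 hy δ hδ)
  obtain ⟨S, hS⟩ := eventually_atBot.1 ((near hxa).and (near hxa'))
  have heq : ∀ t < min S T, x' t = x t := fun t hlt => by
    have hlT := hlt.trans_le (min_le_right _ _)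
    have h := hS t (hlt.le.trans (min_le_left _ _))
    exact (huniq t hlT i).unique ⟨h.2, hx'.2 t (hmem t hlT)⟩ ⟨h.1, hx.2 t (hmem t hlT)⟩
  have hlt : min S T - 1 < min S T := by linarith
  refine hx'.1.eqOn_of_preconnected_of_eventuallyEq hx.1
    (ordConnected_pastTimes k₁ k₂ σ).isPreconnected
    (hmem _ (hlt.trans_le (min_le_right _ _))) ?_
  filter_upwards [Iio_mem_nhds hlt] with t ht
  exact heq t ht

theorem IsZeroCurve.exists_asympTo_past {k₁ k₂ : ℝ} (hk₁ : 0 < k₁) (hk₂ : k₁ < k₂) {σ : ℤˣ}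
    {x : ℝ → ℂ} (hx : IsZeroCurve k₁ k₂ σ (pastTimes k₁ k₂ σ) x) :
    ∃ i, AsympTo atBot x (pastPole k₁ k₂ i) := by
  obtain ⟨δ, hδ, T, hT, hsep, hloc, -⟩ := exists_past_description hk₁ hk₂ σ
  have ht : T - 1 < T := by linarith
  obtain ⟨i, hi⟩ := hloc _ ht (x (T - 1))
    (hx.2 _ (Iio_zero_subset_pastTimes k₁ k₂ σ (ht.trans_le hT)))
  exact ⟨i, hx.asympTo_of_near hk₁ hk₂ hT hsep hloc ht hi⟩

/-! ### Reflection in space-time and the case `t → ∞` -/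

theorem neg_mem_futureTimes {k₁ k₂ : ℝ} {σ : ℤˣ} {t : ℝ} :
    -t ∈ futureTimes k₁ k₂ σ ↔ t ∈ pastTimes k₁ k₂ σ := by
  simp [futureTimes, pastTimes]

theorem neg_mem_pastTimes {k₁ k₂ : ℝ} {σ : ℤˣ} {t : ℝ} :
    -t ∈ pastTimes k₁ k₂ σ ↔ t ∈ futureTimes k₁ k₂ σ := by
  simp [futureTimes, pastTimes]

/-- The point reflection of a curve in space-time. -/
def reflect (x : ℝ → ℂ) (t : ℝ) : ℂ := -x (-t)

@[simp]
theorem reflect_reflect (x : ℝ → ℂ) : reflect (reflect x) = x := by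
  funext t
  simp [reflect]

theorem IsZeroCurve.reflect {k₁ k₂ : ℝ} {σ : ℤˣ} {J J' : Set ℝ} {x : ℝ → ℂ}
    (hx : IsZeroCurve k₁ k₂ σ J x) (hJ : ∀ t ∈ J', -t ∈ J) :
    IsZeroCurve k₁ k₂ σ J' (reflect x) :=
  ⟨fun t ht => ((hx.1 _ (hJ t ht)).comp (analyticAt_id.neg)).neg,
    fun t ht => by
      rw [MKdV.reflect, ← F_neg_neg_eq_zero_iff, neg_neg]
      exact hx.2 _ (hJ t ht)⟩

theorem AsympTo.reflect {l l' : Filter ℝ} (hl : Tendsto (fun t : ℝ => -t) l' l) {x y : ℝ → ℂ}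
    (h : AsympTo l x y) : AsympTo l' (reflect x) (reflect y) := by
  have h' := (h.comp hl).neg
  rw [neg_zero] at h'
  refine h'.congr fun t => ?_
  simp only [Function.comp, MKdV.reflect]
  ring

theorem ExistsUniqueZeroCurve.reflect {k₁ k₂ : ℝ} {σ : ℤˣ} {y : ℝ → ℂ}
    (h : ExistsUniqueZeroCurve k₁ k₂ σ (pastTimes k₁ k₂ σ) atBot y) :
    ExistsUniqueZeroCurve k₁ k₂ σ (futureTimes k₁ k₂ σ) atTop (reflect y) := by
  obtain ⟨x, ⟨hx, hxa⟩, huniq⟩ := h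
  refine ⟨MKdV.reflect x, ⟨hx.reflect fun _ => neg_mem_pastTimes.2,
    hxa.reflect tendsto_neg_atTop_atBot⟩, fun x' hx' hxa' t ht => ?_⟩
  have := huniq (MKdV.reflect x') (hx'.reflect fun _ => neg_mem_futureTimes.2)
    (by simpa using hxa'.reflect tendsto_neg_atBot_atTop) (neg_mem_pastTimes.2 ht)
  simp only [MKdV.reflect, neg_neg] at this ⊢
  rw [← this, neg_neg]

/-- The velocity is unchanged while the centre and the index change sign: hence the opposite phase
shifts and the index `-m` as `t → ∞`. -/
theorem reflect_solitonPole (k a : ℝ) (m : ℤ) :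
    reflect (solitonPole k a m) = solitonPole k (-a) (-m) := by
  funext t
  simp only [reflect, solitonPole]
  push_cast
  ring

end MKdV

theorem mainTheorem1 (k₁ k₂ : ℝ) (hk₁ : 0 < k₁) (hk₂ : k₁ < k₂) (σ : ℤˣ) :
    -- the zeros of `F^±(·,t)` are the poles of `u^±(·,t)`
    (∀ (t : ℝ) (z : ℂ),
      meromorphicOrderAt (fun y : ℂ => MKdV.u k₁ k₂ σ y t) z < 0 ↔ MKdV.F k₁ k₂ σ z t = 0) ∧
    -- slow curves as `t → -∞`
    (∀ m : ℤ, Odd m →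
      MKdV.ExistsUniqueZeroCurve k₁ k₂ σ (MKdV.pastTimes k₁ k₂ σ) atBot
        (MKdV.solitonPole k₁ (1 / k₁ * Real.log (MKdV.gam k₁ k₂)) m)) ∧
    -- slow curves as `t → ∞`
    (∀ m : ℤ, Odd m →
      MKdV.ExistsUniqueZeroCurve k₁ k₂ σ (MKdV.futureTimes k₁ k₂ σ) atTop
        (MKdV.solitonPole k₁ (-(1 / k₁ * Real.log (MKdV.gam k₁ k₂))) (-m))) ∧
    -- fast curves as `t → -∞`
    (∀ n : ℤ, Odd n →
      MKdV.ExistsUniqueZeroCurve k₁ k₂ σ (MKdV.pastTimes k₁ k₂ σ) atBot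
        (MKdV.solitonPole k₂ (-(1 / k₂ * Real.log (MKdV.gam k₁ k₂))) n)) ∧
    -- fast curves as `t → ∞`
    (∀ n : ℤ, Odd n →
      MKdV.ExistsUniqueZeroCurve k₁ k₂ σ (MKdV.futureTimes k₁ k₂ σ) atTop
        (MKdV.solitonPole k₂ (1 / k₂ * Real.log (MKdV.gam k₁ k₂)) (-n))) ∧
    -- every curve of zeros is one of these as `t → -∞`, and one of these as `t → ∞`
    (∀ x : ℝ → ℂ, MKdV.IsZeroCurve k₁ k₂ σ (MKdV.pastTimes k₁ k₂ σ) x →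
      (∃ m : ℤ, Odd m ∧ MKdV.AsympTo atBot x
        (MKdV.solitonPole k₁ (1 / k₁ * Real.log (MKdV.gam k₁ k₂)) m)) ∨
      (∃ n : ℤ, Odd n ∧ MKdV.AsympTo atBot x
        (MKdV.solitonPole k₂ (-(1 / k₂ * Real.log (MKdV.gam k₁ k₂))) n))) ∧
    (∀ x : ℝ → ℂ, MKdV.IsZeroCurve k₁ k₂ σ (MKdV.futureTimes k₁ k₂ σ) x →
      (∃ m : ℤ, Odd m ∧ MKdV.AsympTo atTop x
        (MKdV.solitonPole k₁ (-(1 / k₁ * Real.log (MKdV.gam k₁ k₂))) (-m))) ∨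
      (∃ n : ℤ, Odd n ∧ MKdV.AsympTo atTop x
        (MKdV.solitonPole k₂ (1 / k₂ * Real.log (MKdV.gam k₁ k₂)) (-n)))) ∧
    -- every zero lies on such a curve
    (∀ t ∈ MKdV.pastTimes k₁ k₂ σ, ∀ z : ℂ, MKdV.F k₁ k₂ σ z t = 0 →
      ∃ x : ℝ → ℂ, MKdV.IsZeroCurve k₁ k₂ σ (MKdV.pastTimes k₁ k₂ σ) x ∧ x t = z) ∧
    (∀ t ∈ MKdV.futureTimes k₁ k₂ σ, ∀ z : ℂ, MKdV.F k₁ k₂ σ z t = 0 →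
      ∃ x : ℝ → ℂ, MKdV.IsZeroCurve k₁ k₂ σ (MKdV.futureTimes k₁ k₂ σ) x ∧ x t = z) := by
  refine ⟨fun t z => MKdV.meromorphicOrderAt_u_neg_iff hk₁ hk₂ σ t z,
    fun m hm => MKdV.existsUniqueZeroCurve_past hk₁ hk₂ σ (true, ⟨m, hm⟩), fun m hm => ?_,
    fun n hn => MKdV.existsUniqueZeroCurve_past hk₁ hk₂ σ (false, ⟨n, hn⟩), fun n hn => ?_,
    fun x hx => ?_, fun x hx => ?_, fun t ht z hz => MKdV.exists_isZeroCurve_past hk₁ hk₂ ht hz,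
    fun t ht z hz => ?_⟩
  · rw [← MKdV.reflect_solitonPole]
    exact (MKdV.existsUniqueZeroCurve_past hk₁ hk₂ σ (true, ⟨m, hm⟩)).reflect
  · rw [← neg_neg (1 / k₂ * Real.log (MKdV.gam k₁ k₂)), ← MKdV.reflect_solitonPole]
    exact (MKdV.existsUniqueZeroCurve_past hk₁ hk₂ σ (false, ⟨n, hn⟩)).reflect
  · obtain ⟨⟨i, m, hm⟩, h⟩ := hx.exists_asympTo_past hk₁ hk₂
    cases i
    · exact Or.inr ⟨m, hm, h⟩
    · exact Or.inl ⟨m, hm, h⟩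
  · obtain ⟨⟨i, m, hm⟩, h⟩ :=
      (hx.reflect fun _ => MKdV.neg_mem_futureTimes.2).exists_asympTo_past hk₁ hk₂
    have h' := h.reflect tendsto_neg_atTop_atBot
    rw [MKdV.reflect_reflect] at h'
    cases i
    · refine Or.inr ⟨m, hm, ?_⟩
      rw [← neg_neg (1 / k₂ * Real.log (MKdV.gam k₁ k₂)), ← MKdV.reflect_solitonPole]
      exact h'
    · refine Or.inl ⟨m, hm, ?_⟩
      rw [← MKdV.reflect_solitonPole]
      exact h'
  · obtain ⟨x, hx, hxt⟩ := MKdV.exists_isZeroCurve_past hk₁ hk₂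
      (MKdV.neg_mem_pastTimes.2 ht) ((MKdV.F_neg_neg_eq_zero_iff k₁ k₂ σ z t).2 hz)
    exact ⟨MKdV.reflect x, hx.reflect fun _ => MKdV.neg_mem_pastTimes.2, by
      rw [MKdV.reflect, hxt, neg_neg]⟩
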